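/- Let $\lambda\in\mathbb R$, $\lambda\neq 0$, and $\delta\in\mathbb C$ with $\mathrm{Re}(\delta)>0$. Put $(1)_{n,\lambda}=\prod_{k=0}^{n-1}(1-k\lambda)$ and $e_\lambda(y)=(1+\lambda y)^{1/\lambda}$ (principal power), and let $D_\lambda=\mathbb C$ if $1/\lambda\in\mathbb N=\{1,2,\dots\}$ and $D_\lambda=\{y\in\mathbb C:\ 1+\lambda y\notin(-\infty,0]\}$ otherwise. For $s\in\mathbb C$ the series $$e_\lambda(x,\delta|s)=\sum_{n=0}^\infty\frac{(1)_{n,\lambda}}{n!\,(n+\delta)^s}x^n$$ converges absolutely for $|\lambda x|<1$, and the function $x\mapsto e_\lambda(x,\delta|s)$, defined by the series wherever this converges absolutely and by analytic continuation elsewhere, is holomorphic on $D_\lambda$. For $c,\eta>0$ let $H_{c,\eta}$ be the Hankel contour that runs from $-\infty$ along $\mathrm{Im}\,t=-\eta$ to $c-i\eta$, then straight to $c+i\eta$, and back to $-\infty$ along $\mathrm{Im}\,t=\eta$, and let $\int_{-\infty}^{(0+)}$ denote the integral along $H_{c,\eta}$; powers $t^{s-1}$ and $\mathrm{Log}\,t$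 are principal. Call $(c,\eta)$ admissible for $x$ if $xe^t\in D_\lambda$ whenever $\mathrm{Re}\,t\le c$ and $|\mathrm{Im}\,t|\le\eta$. Let $x\in D_\lambda$. Then all sufficiently small $c,\eta>0$ are admissible for $x$, and for every admissible $(c,\eta)$ the integrals below converge absolutely and the following hold. If $s\in\mathbb C\setminus\mathbb N$, then $$e_\lambda(x,\delta|s)=\frac{\Gamma(1-s)}{2\pi i}\int_{-\infty}^{(0+)}t^{s-1}e^{\delta t}e_\lambda(xe^t)\,dt .$$ If $m\in\mathbb N$, then $$e_\lambda(x,\delta|m)=\lim_{s\to m,\ s\neq m}\frac{\Gamma(1-s)}{2\pi i}\int_{-\infty}^{(0+)}t^{s-1}e^{\delta t}e_\lambda(xe^t)\,dt=\frac{(-1)^m}{2\pi i\,(m-1)!}\int_{-\infty}^{(0+)}t^{m-1}e^{\delta t}e_\lambda(xe^t)\,\mathrm{Log}\,t\,dt .$$ -/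

import Mathlib

open Complex MeasureTheory Filter Topology

/-- The degenerate falling factorial
`(a)_{n,λ} = a (a - λ) (a - 2λ) ⋯ (a - (n-1)λ)`, with `(a)_{0,λ} = 1`. -/
def degFalling (lam a : ℝ) (n : ℕ) : ℝ :=
  ∏ k ∈ Finset.range n, (a - (k : ℝ) * lam)

/-- The degenerate exponential function `e_λ(y) = (1 + λ y)^{1/λ}` (principal power). -/
noncomputable def degExp (lam : ℝ) (y : ℂ) : ℂ :=
  (1 + (lam : ℂ) * y) ^ (1 / (lam : ℂ))

/-- The region of holomorphy of the principal branch of `e_λ`: the whole plane if `1/λ` is a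
natural number (then `e_λ` is a polynomial), and otherwise the plane cut along the ray of those
`y` for which `1 + λ y` is real and nonpositive. -/
def degExpDomain (lam : ℝ) : Set ℂ :=
  {y | 1 + (lam : ℂ) * y ∈ slitPlane ∨ ∃ N : ℕ, lam * (N : ℝ) = 1}

/-- The `n`-th term `(1)_{n,λ} x^n / (n! (n + δ)^s)` of the degenerate polyexponential series. -/
noncomputable def degPolyexpTerm (lam : ℝ) (x δ s : ℂ) (n : ℕ) : ℂ :=
  (degFalling lam 1 n : ℂ) / ((n.factorial : ℂ) * ((n : ℂ) + δ) ^ s) * x ^ n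

/-- `E` is holomorphic on `degExpDomain lam` and is the sum of the degenerate polyexponential
series on the disc `|λ x| < 1`. As the domain is star-shaped about `0`, this determines `E` on
the domain. -/
structure IsDegPolyexpContinuation (lam : ℝ) (δ s : ℂ) (E : ℂ → ℂ) : Prop where
  analytic : AnalyticOnNhd ℂ E (degExpDomain lam)
  hasSum : ∀ x : ℂ, ‖(lam : ℂ) * x‖ < 1 → HasSum (degPolyexpTerm lam x δ s) (E x)

open Classical in
/-- The degenerate polyexponential function `e_λ(x, δ | s)`: the sum of its series
`∑ (1)_{n,λ} x^n / (n! (n + δ)^s)` where this converges absolutely, and the analytic continuation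
in `x` of that sum elsewhere. -/
noncomputable def degPolyexp (lam : ℝ) (x δ s : ℂ) : ℂ :=
  if Summable (degPolyexpTerm lam x δ s) then ∑' n, degPolyexpTerm lam x δ s n
  else if h : ∃ E : ℂ → ℂ, IsDegPolyexpContinuation lam δ s E then h.choose x
  else 0

/-- The integral `∫_{-∞}^{(0+)} f(t) dt` along the Hankel contour that comes from `-∞` along the
line `Im t = -η` to `c - iη`, goes up to `c + iη`, and returns to `-∞` along `Im t = η`. For
`c, η > 0` it encircles the origin once counter-clockwise and does not meet the cut `(-∞, 0]`
of the principal logarithm. -/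
noncomputable def hankelIntegral (c η : ℝ) (f : ℂ → ℂ) : ℂ :=
  (∫ u in Set.Iic c, f ((u : ℂ) - (η : ℂ) * I))
    + I * (∫ v in (-η)..η, f ((c : ℂ) + (v : ℂ) * I))
    - ∫ u in Set.Iic c, f ((u : ℂ) + (η : ℂ) * I)

/-- The integral of `f` along the Hankel contour of `hankelIntegral` converges absolutely. -/
def HankelIntegrable (c η : ℝ) (f : ℂ → ℂ) : Prop :=
  IntegrableOn (fun u : ℝ => f ((u : ℂ) - (η : ℂ) * I)) (Set.Iic c) ∧
  IntervalIntegrable (fun v : ℝ => f ((c : ℂ) + (v : ℂ) * I)) volume (-η) η ∧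
  IntegrableOn (fun u : ℝ => f ((u : ℂ) + (η : ℂ) * I)) (Set.Iic c)

/-- The Hankel contour with parameters `c`, `η` is admissible for `x`: `t ↦ e_λ(x e^t)` has no
singularity on it or inside it, that is, on the half-strip `Re t ≤ c`, `|Im t| ≤ η`. -/
def HankelAdmissible (lam : ℝ) (x : ℂ) (c η : ℝ) : Prop :=
  0 < c ∧ 0 < η ∧ ∀ t : ℂ, t.re ≤ c → |t.im| ≤ η → x * exp t ∈ degExpDomain lam

/-! In the binomial series of `e_λ(x e^t)` the variable `t` enters only through `e^{nt}`. Hankel's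
formula `∫ t^{s-1} e^{at} dt = 2πi a^{-s} / Γ(1-s)`, valid for `Re a > 0`, applied with `a = n + δ`,
produces `(n + δ)^{-s}` term by term, so for small `x` the contour integral is the defining series.
The integral is holomorphic in `x` on the set of admissible `x`, which is open and star-shaped about
`0`, and the identity theorem does the rest.

`HasPolyMoments` isolates what is used of a kernel: its moments against `e^{nz}`. By
`integral_mul_degExp_eq_of_moments` the integral of `κ(z) e_λ(x e^z)` depends on these moments
alone, not on the contour. Hence the integrals over different contours glue to a continuation on the
whole domain (`exists_isDegPolyexpContinuation`), and no contour is deformed in the presence of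
`e_λ`.

Hankel's formula is proved for real `s > 1` and `a > 0` by collapsing the contour onto the cut, then
continued in `s`, then in `a`. At `s = m` the factor `1/Γ(1-s)` has a simple zero. Differentiating
the formula there gives the logarithmic kernel, and the limit is a quotient of two functions
vanishing at `m`. -/

/-! ### The Hankel contour as a measure with a unit tangent. -/

/-- Arc length measure on the Hankel contour. -/
noncomputable def hankelMeasure (c η : ℝ) : Measure ℂ :=
  ((volume.restrict (Set.Iic c)).map (fun u : ℝ => (u : ℂ) - (η : ℂ) * I)
    + (volume.restrict (Set.Ioo (-η) η)).map (fun v : ℝ => (c : ℂ) + (v : ℂ) * I))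
    + (volume.restrict (Set.Iic c)).map (fun u : ℝ => (u : ℂ) + (η : ℂ) * I)

open Classical in
/-- The unit tangent of the Hankel contour at a point. -/
noncomputable def hankelDir (η : ℝ) (z : ℂ) : ℂ :=
  if z.im = -η then 1 else if z.im = η then -1 else I

/-- The closed half-strip around the Hankel contour, with a neighbourhood of `0` removed. -/
def hankelRegion (c η : ℝ) : Set ℂ :=
  {z | min c η ≤ ‖z‖ ∧ z.re ≤ c ∧ |z.im| ≤ η}

lemma measurable_hankelDir (η : ℝ) : Measurable (hankelDir η) := by
  unfold hankelDir
  refine Measurable.ite (measurableSet_eq_fun measurable_im measurable_const) measurable_const ?_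
  exact Measurable.ite (measurableSet_eq_fun measurable_im measurable_const) measurable_const
    measurable_const

lemma norm_hankelDir (η : ℝ) (z : ℂ) : ‖hankelDir η z‖ = 1 := by
  unfold hankelDir
  split_ifs <;> simp

lemma measurableEmbedding_horizontal (w : ℂ) : MeasurableEmbedding (fun u : ℝ => (u : ℂ) + w) :=
  Continuous.measurableEmbedding (by fun_prop) fun u v h => by simpa using h

lemma measurableEmbedding_horizontal_sub (w : ℂ) :
    MeasurableEmbedding (fun u : ℝ => (u : ℂ) - w) :=
  Continuous.measurableEmbedding (by fun_prop) fun u v h => by simpa using h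

lemma measurableEmbedding_vertical (w : ℂ) :
    MeasurableEmbedding (fun v : ℝ => w + (v : ℂ) * I) :=
  Continuous.measurableEmbedding (by fun_prop) fun u v h => by simpa using h

lemma intervalIntegrable_iff_integrableOn_Ioo_neg {η : ℝ} (hη : 0 < η) (f : ℝ → ℂ) :
    IntervalIntegrable f volume (-η) η ↔ IntegrableOn f (Set.Ioo (-η) η) := by
  rw [intervalIntegrable_iff_integrableOn_Ioo_of_le (by linarith)]

lemma hankelIntegrable_iff {c η : ℝ} (hη : 0 < η) (f : ℂ → ℂ) :
    HankelIntegrable c η f ↔ Integrable f (hankelMeasure c η) := by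
  unfold HankelIntegrable hankelMeasure
  rw [integrable_add_measure, integrable_add_measure,
    (measurableEmbedding_horizontal_sub _).integrable_map_iff,
    (measurableEmbedding_horizontal _).integrable_map_iff,
    (measurableEmbedding_vertical _).integrable_map_iff,
    intervalIntegrable_iff_integrableOn_Ioo_neg hη, and_assoc]
  rfl

lemma integrable_hankelDir_mul_iff {η : ℝ} {μ : Measure ℂ} {f : ℂ → ℂ}
    (hf : Integrable f μ) : Integrable (fun z => hankelDir η z * f z) μ :=
  hf.bdd_mul (c := 1) (measurable_hankelDir η).aestronglyMeasurable
    (ae_of_all _ fun z => (norm_hankelDir η z).le)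

/-- A single integral against a measure makes dominated convergence and differentiation under the
integral available for all three pieces at once. The orientation is carried by `hankelDir`. -/
lemma hankelIntegral_eq {c η : ℝ} (hη : 0 < η) {f : ℂ → ℂ}
    (hf : Integrable f (hankelMeasure c η)) :
    hankelIntegral c η f = ∫ z, hankelDir η z * f z ∂hankelMeasure c η := by
  have h := integrable_hankelDir_mul_iff (η := η) hf
  unfold hankelMeasure at h ⊢
  rw [integral_add_measure (integrable_add_measure.1 h).1 (integrable_add_measure.1 h).2,
    integral_add_measure (integrable_add_measure.1 (integrable_add_measure.1 h).1).1
      (integrable_add_measure.1 (integrable_add_measure.1 h).1).2,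
    (measurableEmbedding_horizontal_sub _).integral_map,
    (measurableEmbedding_horizontal _).integral_map,
    (measurableEmbedding_vertical _).integral_map]
  unfold hankelIntegral
  have h1 : ∀ u : ℝ, hankelDir η ((u : ℂ) - η * I) = 1 := fun u => by simp [hankelDir]
  have h2 : ∀ u : ℝ, hankelDir η ((u : ℂ) + η * I) = -1 := fun u => by
    have : η ≠ -η := by intro h; linarith
    simp [hankelDir, this]
  -- At the corners `v = ±η` the tangent is that of the horizontal rays. The open interval leaves
  -- them out.
  have h3 : ∫ v in Set.Ioo (-η) η, hankelDir η ((c : ℂ) + v * I) * f ((c : ℂ) + v * I)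
      = I * ∫ v in Set.Ioo (-η) η, f ((c : ℂ) + v * I) := by
    rw [← integral_const_mul]
    refine setIntegral_congr_fun measurableSet_Ioo fun v hv => ?_
    have e1 : v ≠ -η := hv.1.ne'
    have e2 : v ≠ η := hv.2.ne
    simp [hankelDir, e1, e2]
  rw [h3, intervalIntegral.integral_of_le (by linarith), integral_Ioc_eq_integral_Ioo]
  simp only [h1, h2, one_mul, neg_mul, integral_neg]
  ring

lemma ae_hankelMeasure {c η : ℝ} (hc : 0 < c) (hη : 0 < η) :
    ∀ᵐ z ∂hankelMeasure c η, z ∈ hankelRegion c η := by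
  unfold hankelMeasure
  rw [ae_add_measure_iff, ae_add_measure_iff, (measurableEmbedding_horizontal_sub _).ae_map_iff,
    (measurableEmbedding_horizontal _).ae_map_iff, (measurableEmbedding_vertical _).ae_map_iff]
  refine ⟨⟨?_, ?_⟩, ?_⟩
  · refine (ae_restrict_mem measurableSet_Iic).mono fun u hu => ?_
    refine ⟨(min_le_right _ _).trans ((le_of_eq ?_).trans (abs_im_le_norm _)), ?_, ?_⟩
    · simp [abs_of_pos hη]
    · simpa using hu
    · simp [abs_of_pos hη]
  · refine (ae_restrict_mem measurableSet_Ioo).mono fun v hv => ?_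
    refine ⟨(min_le_left _ _).trans ((le_of_eq ?_).trans (abs_re_le_norm _)), ?_, ?_⟩
    · simp [abs_of_pos hc]
    · simp
    · simpa using abs_le.2 ⟨hv.1.le, hv.2.le⟩
  · refine (ae_restrict_mem measurableSet_Iic).mono fun u hu => ?_
    refine ⟨(min_le_right _ _).trans ((le_of_eq ?_).trans (abs_im_le_norm _)), ?_, ?_⟩
    · simp [abs_of_pos hη]
    · simpa using hu
    · simp [abs_of_pos hη]

lemma integrable_exp_hankelMeasure (c η : ℝ) {b : ℝ} (hb : 0 < b) :
    Integrable (fun z : ℂ => Real.exp (b * z.re)) (hankelMeasure c η) := by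
  unfold hankelMeasure
  rw [integrable_add_measure, integrable_add_measure,
    (measurableEmbedding_horizontal_sub _).integrable_map_iff,
    (measurableEmbedding_horizontal _).integrable_map_iff,
    (measurableEmbedding_vertical _).integrable_map_iff]
  refine ⟨⟨?_, ?_⟩, ?_⟩
  · simpa [Function.comp_def] using! integrableOn_exp_mul_Iic hb c
  · simp [Function.comp_def]
  · simpa [Function.comp_def] using! integrableOn_exp_mul_Iic hb c

/-! ### Growth bounds near the contour and differentiation in parameters. -/

/-- Up to the bounded argument, `‖log z‖` is `|log ‖z‖|`. The logarithm of `‖z‖` is bounded below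
away from `0`, and above by a line of slope `1/k`. The choice `k = M / b` makes `M` times this line
cost exactly `-b * z.re` plus a constant. -/
lemma exp_norm_log_le_on_hankelRegion {c η : ℝ} (hc : 0 < c) (hη : 0 < η) {M b : ℝ} (hM : 0 < M)
    (hb : 0 < b) : ∃ C : ℝ, 0 < C ∧
      ∀ z ∈ hankelRegion c η, Real.exp (M * ‖log z‖) ≤ C * Real.exp (-b * z.re) := by
  set r := min c η with hr
  have hr0 : 0 < r := lt_min hc hη
  set k : ℝ := M / b with hk
  have hk0 : 0 < k := by positivity
  refine ⟨Real.exp (M * (|Real.log r| + |Real.log k| + (2 * c + η) / k + Real.pi)),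
    Real.exp_pos _, fun z hz => ?_⟩
  obtain ⟨h1, h2, h3⟩ := hz
  have hz0 : 0 < ‖z‖ := hr0.trans_le h1
  rw [← Real.exp_add]
  refine Real.exp_le_exp.2 ?_
  have hlog : ‖log z‖ ≤ |Real.log ‖z‖| + Real.pi := by
    refine (norm_le_abs_re_add_abs_im _).trans ?_
    rw [log_re, log_im]
    exact add_le_add le_rfl (abs_arg_le_pi z)
  have hnorm : ‖z‖ ≤ 2 * c + η - z.re := by
    have := norm_le_abs_re_add_abs_im z
    -- The constant `2 * c` covers both signs, because `z.re ≤ c` and `c > 0`.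
    have : |z.re| ≤ 2 * c - z.re := abs_le.2 ⟨by linarith, by linarith⟩
    linarith
  have hup : Real.log ‖z‖ ≤ |Real.log k| + (2 * c + η) / k - z.re / k := by
    have e : Real.log ‖z‖ = Real.log k + Real.log (‖z‖ / k) := by
      rw [Real.log_div hz0.ne' hk0.ne']; ring
    have e2 := Real.log_le_sub_one_of_pos (div_pos hz0 hk0)
    have e3 : ‖z‖ / k ≤ (2 * c + η - z.re) / k := by gcongr
    have e4 : (2 * c + η - z.re) / k = (2 * c + η) / k - z.re / k := by ring
    have := le_abs_self (Real.log k)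
    linarith
  have hlo : -|Real.log r| ≤ Real.log ‖z‖ :=
    (neg_abs_le _).trans (Real.log_le_log hr0 h1)
  have hzk : 0 ≤ (2 * c + η) / k - z.re / k := by
    rw [← sub_div]; exact div_nonneg (by linarith) hk0.le
  have habs : |Real.log ‖z‖| ≤ |Real.log r| + |Real.log k| + (2 * c + η) / k - z.re / k := by
    refine abs_le.2 ⟨?_, ?_⟩
    · have := abs_nonneg (Real.log k); linarith
    · have := abs_nonneg (Real.log r); linarith
  have hMb : M * (z.re / k) = b * z.re := by
    rw [hk]; field_simp
  have := mul_le_mul_of_nonneg_left (hlog.trans (add_le_add habs le_rfl)) hM.le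
  linarith

lemma ne_zero_of_mem_hankelRegion {c η : ℝ} (hc : 0 < c) (hη : 0 < η) {z : ℂ}
    (hz : z ∈ hankelRegion c η) : z ≠ 0 := by
  rintro rfl
  have := hz.1
  rw [norm_zero] at this
  exact absurd (lt_min hc hη) (not_lt.2 this)

lemma integrable_of_norm_le_exp {c η : ℝ} (hc : 0 < c) (hη : 0 < η) {f : ℂ → ℂ}
    (hf : Measurable f) {b C : ℝ} (hb : 0 < b)
    (h : ∀ z ∈ hankelRegion c η, ‖f z‖ ≤ C * Real.exp (b * z.re)) :
    Integrable f (hankelMeasure c η) :=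
  ((integrable_exp_hankelMeasure c η hb).const_mul C).mono' hf.aestronglyMeasurable
    ((ae_hankelMeasure hc hη).mono h)

lemma norm_exp_mul_le_exp (w z : ℂ) : ‖exp (w * z)‖ ≤ Real.exp (‖w‖ * ‖z‖) :=
  (norm_exp_le_exp_norm _).trans (by rw [norm_mul])

/-- Differentiation of `w ↦ ∫ exp (w φ) h` under the integral sign. -/
lemma hasDerivAt_integral_exp_mul {μ : Measure ℂ} {φ h : ℂ → ℂ} (hφ : Measurable φ)
    (hh : Measurable h) {w₀ : ℂ} {ε : ℝ} (hε : 0 < ε)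
    (hint : Integrable (fun z => Real.exp (ε * ‖φ z‖) * ‖exp (w₀ * φ z) * h z‖) μ) :
    Integrable (fun z => φ z * exp (w₀ * φ z) * h z) μ ∧
      HasDerivAt (fun w => ∫ z, exp (w * φ z) * h z ∂μ)
        (∫ z, φ z * exp (w₀ * φ z) * h z ∂μ) w₀ := by
  -- Half of `ε` pays for moving `w` away from `w₀`, the other half for the factor `φ z`, by `t ≤
  -- exp t`.
  refine hasDerivAt_integral_of_dominated_loc_of_deriv_le (s := Metric.ball w₀ (ε / 2))
    (F := fun w z => exp (w * φ z) * h z) (F' := fun w z => φ z * exp (w * φ z) * h z)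
    (bound := fun z => 2 / ε * (Real.exp (ε * ‖φ z‖) * ‖exp (w₀ * φ z) * h z‖))
    (Metric.ball_mem_nhds _ (by positivity)) (Eventually.of_forall fun w => ?_) ?_ ?_ ?_
    (hint.const_mul _) ?_
  · exact Measurable.aestronglyMeasurable (by fun_prop)
  · refine hint.mono' (Measurable.aestronglyMeasurable (by fun_prop)) (ae_of_all _ fun z => ?_)
    exact le_mul_of_one_le_left (norm_nonneg _) (Real.one_le_exp (by positivity))
  · exact Measurable.aestronglyMeasurable (by fun_prop)
  · refine ae_of_all _ fun z w hw => ?_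
    have h1 : ‖w - w₀‖ ≤ ε / 2 := (mem_ball_iff_norm.1 hw).le
    have h2 : ‖exp ((w - w₀) * φ z)‖ ≤ Real.exp (ε / 2 * ‖φ z‖) :=
      (norm_exp_mul_le_exp _ _).trans (Real.exp_le_exp.2 (by gcongr))
    have h3 : ‖φ z‖ ≤ 2 / ε * Real.exp (ε / 2 * ‖φ z‖) := by
      have := Real.add_one_le_exp (ε / 2 * ‖φ z‖)
      calc ‖φ z‖ = 2 / ε * (ε / 2 * ‖φ z‖) := by field_simp
        _ ≤ _ := by gcongr; linarith
    have h4 : exp (w * φ z) = exp ((w - w₀) * φ z) * exp (w₀ * φ z) := by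
      rw [← exp_add]; ring_nf
    have h5 : Real.exp (ε * ‖φ z‖) = Real.exp (ε / 2 * ‖φ z‖) * Real.exp (ε / 2 * ‖φ z‖) := by
      rw [← Real.exp_add]; ring_nf
    calc ‖φ z * exp (w * φ z) * h z‖
        = ‖φ z‖ * ‖exp ((w - w₀) * φ z)‖ * ‖exp (w₀ * φ z) * h z‖ := by
          rw [h4]; simp only [norm_mul]; ring
      _ ≤ (2 / ε * Real.exp (ε / 2 * ‖φ z‖)) * Real.exp (ε / 2 * ‖φ z‖)
            * ‖exp (w₀ * φ z) * h z‖ := by gcongr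
      _ = _ := by rw [h5]; ring
  · refine ae_of_all _ fun z w _ => ?_
    exact (((hasDerivAt_id' w).mul_const (φ z)).cexp.mul_const (h z)).congr_deriv (by ring)

lemma norm_exp_mul_re (a z : ℂ) {c η : ℝ} (hz : z ∈ hankelRegion c η) :
    ‖exp (a * z)‖ ≤ Real.exp (‖a‖ * η) * Real.exp (a.re * z.re) := by
  rw [norm_exp, ← Real.exp_add, mul_re]
  refine Real.exp_le_exp.2 ?_
  have : -(a.im * z.im) ≤ ‖a‖ * η := by
    refine (neg_le_abs _).trans ?_
    rw [abs_mul]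
    exact mul_le_mul (abs_im_le_norm a) hz.2.2 (abs_nonneg _) (norm_nonneg _)
  linarith

/-- Powers are absorbed by a fraction of exponential decay, with room for `exp (M ‖log z‖)`. -/
lemma exists_exp_log_mul_cpow_bound {c η : ℝ} (hc : 0 < c) (hη : 0 < η) (s : ℂ) {M b : ℝ}
    (hM : 0 ≤ M) (hb : 0 < b) {C₀ : ℝ} {h : ℂ → ℂ}
    (hh : ∀ z ∈ hankelRegion c η, ‖h z‖ ≤ C₀ * Real.exp (b * z.re)) :
    ∃ C : ℝ, 0 ≤ C ∧ ∀ z ∈ hankelRegion c η,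
      Real.exp (M * ‖log z‖) * ‖exp (s * log z) * h z‖ ≤ C * Real.exp (b / 2 * z.re) := by
  -- The summand `1` only makes the exponent positive. Half of the decay rate `b` is spent on the
  -- logarithm.
  obtain ⟨C, hC, hCb⟩ := exp_norm_log_le_on_hankelRegion hc hη
    (M := M + ‖s‖ + 1) (by positivity) (half_pos hb)
  refine ⟨C * |C₀|, by positivity, fun z hz => ?_⟩
  have h1 : ‖exp (s * log z)‖ ≤ Real.exp (‖s‖ * ‖log z‖) := norm_exp_mul_le_exp _ _
  have h2 : ‖h z‖ ≤ |C₀| * Real.exp (b * z.re) :=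
    (hh z hz).trans (by gcongr; exact le_abs_self _)
  have h3 : Real.exp (M * ‖log z‖) * Real.exp (‖s‖ * ‖log z‖)
      ≤ Real.exp ((M + ‖s‖ + 1) * ‖log z‖) := by
    rw [← Real.exp_add]
    refine Real.exp_le_exp.2 ?_
    have := norm_nonneg (log z)
    linarith
  calc Real.exp (M * ‖log z‖) * ‖exp (s * log z) * h z‖
      ≤ Real.exp (M * ‖log z‖) * (Real.exp (‖s‖ * ‖log z‖) * (|C₀| * Real.exp (b * z.re))) := by
        rw [norm_mul]; gcongr
    _ = (Real.exp (M * ‖log z‖) * Real.exp (‖s‖ * ‖log z‖)) * (|C₀| * Real.exp (b * z.re)) := by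
        ring
    _ ≤ (C * Real.exp (-(b / 2) * z.re)) * (|C₀| * Real.exp (b * z.re)) := by
        exact mul_le_mul_of_nonneg_right (h3.trans (hCb z hz)) (by positivity)
    _ = C * |C₀| * (Real.exp (-(b / 2) * z.re) * Real.exp (b * z.re)) := by ring
    _ = _ := by rw [← Real.exp_add]; congr 2; ring

lemma cpow_eq_exp_on_hankelRegion {c η : ℝ} (hc : 0 < c) (hη : 0 < η) {z : ℂ}
    (hz : z ∈ hankelRegion c η) (s : ℂ) : z ^ s = exp (s * log z) := by
  rw [cpow_def_of_ne_zero (ne_zero_of_mem_hankelRegion hc hη hz), mul_comm]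

lemma integrable_exp_log_mul_cpow {c η : ℝ} (hc : 0 < c) (hη : 0 < η) (s : ℂ) {M b : ℝ}
    (hM : 0 ≤ M) (hb : 0 < b) {C₀ : ℝ} {h : ℂ → ℂ} (hmeas : Measurable h)
    (hh : ∀ z ∈ hankelRegion c η, ‖h z‖ ≤ C₀ * Real.exp (b * z.re)) :
    Integrable (fun z => Real.exp (M * ‖log z‖) * ‖exp (s * log z) * h z‖)
      (hankelMeasure c η) := by
  obtain ⟨C, _, hC⟩ := exists_exp_log_mul_cpow_bound hc hη s hM hb hh
  refine ((integrable_exp_hankelMeasure c η (half_pos hb)).const_mul C).mono'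
    (Measurable.aestronglyMeasurable (by fun_prop)) ((ae_hankelMeasure hc hη).mono fun z hz => ?_)
  rw [Real.norm_of_nonneg (by positivity)]
  exact hC z hz

/-- The integral of `z ^ (s - 1) h z` along the Hankel contour is differentiable in `s`. -/
lemma hasDerivAt_integral_cpow_mul {c η : ℝ} (hc : 0 < c) (hη : 0 < η) (s : ℂ) {b : ℝ}
    (hb : 0 < b) {C₀ : ℝ} {h : ℂ → ℂ} (hmeas : Measurable h)
    (hh : ∀ z ∈ hankelRegion c η, ‖h z‖ ≤ C₀ * Real.exp (b * z.re)) :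
    Integrable (fun z => log z * z ^ (s - 1) * h z) (hankelMeasure c η) ∧
      HasDerivAt (fun s : ℂ => ∫ z, z ^ (s - 1) * h z ∂hankelMeasure c η)
        (∫ z, log z * z ^ (s - 1) * h z ∂hankelMeasure c η) s := by
  obtain ⟨h1, h2⟩ := hasDerivAt_integral_exp_mul (μ := hankelMeasure c η) measurable_log hmeas
    one_pos (integrable_exp_log_mul_cpow hc hη (s - 1) zero_le_one hb hmeas hh)
  have e : ∀ w : ℂ, (fun z : ℂ => z ^ w) =ᵐ[hankelMeasure c η] fun z => exp (w * log z) :=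
    fun w => (ae_hankelMeasure hc hη).mono fun z hz => cpow_eq_exp_on_hankelRegion hc hη hz w
  constructor
  · exact h1.congr ((e (s - 1)).mono fun z hz => by simp only [hz])
  · have e2 : (fun s : ℂ => ∫ z, z ^ (s - 1) * h z ∂hankelMeasure c η)
        = fun s => ∫ z, exp ((s - 1) * log z) * h z ∂hankelMeasure c η := by
      ext s
      exact integral_congr_ae ((e (s - 1)).mono fun z hz => by simp only [hz])
    have e3 : ∫ z, log z * z ^ (s - 1) * h z ∂hankelMeasure c η
        = ∫ z, log z * exp ((s - 1) * log z) * h z ∂hankelMeasure c η :=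
      integral_congr_ae ((e (s - 1)).mono fun z hz => by simp only [hz])
    rw [e2, e3]
    exact HasDerivAt.comp_sub_const (f := fun w => ∫ z, exp (w * log z) * h z ∂hankelMeasure c η)
      s 1 h2

lemma integrable_cpow_mul {c η : ℝ} (hc : 0 < c) (hη : 0 < η) (s : ℂ) {b : ℝ}
    (hb : 0 < b) {C₀ : ℝ} {h : ℂ → ℂ} (hmeas : Measurable h)
    (hh : ∀ z ∈ hankelRegion c η, ‖h z‖ ≤ C₀ * Real.exp (b * z.re)) :
    Integrable (fun z => z ^ s * h z) (hankelMeasure c η) := by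
  refine (integrable_exp_log_mul_cpow hc hη s le_rfl hb hmeas hh).mono'
    (Measurable.aestronglyMeasurable (by fun_prop)) ((ae_hankelMeasure hc hη).mono fun z hz => ?_)
  simp [cpow_eq_exp_on_hankelRegion hc hη hz]

/-- The integral of `z ^ (s - 1) exp (a z)` along the Hankel contour is differentiable in `a`. -/
lemma differentiableAt_integral_cpow_mul_exp {c η : ℝ} (hc : 0 < c) (hη : 0 < η) (s : ℂ) {a : ℂ}
    (ha : 0 < a.re) {h : ℂ → ℂ} (hmeas : Measurable h)
    (hh : ∀ z ∈ hankelRegion c η, ‖h z‖ ≤ 1) :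
    DifferentiableAt ℂ (fun a : ℂ => ∫ z, exp (a * z) * (z ^ s * h z) ∂hankelMeasure c η) a := by
  refine (hasDerivAt_integral_exp_mul (φ := fun z => z) measurable_id (by fun_prop)
    (half_pos ha) ?_).2.differentiableAt
  -- Since `‖z‖ ≤ 2 * c + η - z.re`, the factor `exp (a.re / 2 * ‖z‖)` uses up half of the decay of
  -- `exp (a * z)`.
  have key := integrable_cpow_mul hc hη s (half_pos ha)
    (h := fun z => (Real.exp (a.re / 2 * ‖z‖) : ℂ) * (exp (a * z) * h z))
    (C₀ := Real.exp (a.re / 2 * (2 * c + η)) * Real.exp (‖a‖ * η)) (by fun_prop) ?_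
  · refine key.norm.congr (ae_of_all _ fun z => ?_)
    simp only [norm_mul, norm_real, Real.norm_of_nonneg (Real.exp_pos _).le]
    ring
  · intro z hz
    have h1 := norm_exp_mul_re a z hz
    have h2 : ‖z‖ ≤ 2 * c + η - z.re := by
      have h3 := norm_le_abs_re_add_abs_im z
      have h4 : |z.re| ≤ 2 * c - z.re :=
        abs_le.2 ⟨by linarith, by linarith [hz.2.1]⟩
      linarith [hz.2.2]
    have h3 : Real.exp (a.re / 2 * ‖z‖)
        ≤ Real.exp (a.re / 2 * (2 * c + η)) * Real.exp (-(a.re / 2) * z.re) := by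
      rw [← Real.exp_add]
      refine Real.exp_le_exp.2 ?_
      have := mul_le_mul_of_nonneg_left h2 (half_pos ha).le
      linarith
    have h4 : Real.exp (a.re / 2 * z.re)
        = Real.exp (-(a.re / 2) * z.re) * Real.exp (a.re * z.re) := by
      rw [← Real.exp_add]; congr 1; ring
    simp only [norm_mul, norm_real, Real.norm_of_nonneg (Real.exp_pos _).le]
    calc _ ≤ (Real.exp (a.re / 2 * (2 * c + η)) * Real.exp (-(a.re / 2) * z.re)) *
          ((Real.exp (‖a‖ * η) * Real.exp (a.re * z.re)) * 1) := by
          gcongr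
          exact hh z hz
      _ = _ := by rw [h4]; ring

/-! ### Hankel's formula for real parameters. -/

section RealParameters

variable {c η a σ : ℝ}

/-- On the cut the principal logarithm takes its limit from above, and at `0` the positive exponent
forces the power to `0`. This permits a contour side lying on the cut. -/
lemma continuousOn_cpow_ofReal_upper (hσ : 0 < σ) :
    ContinuousOn (fun z : ℂ => z ^ (σ : ℂ)) {z | 0 ≤ z.im} := by
  intro z hz
  by_cases hs : z ∈ slitPlane
  · exact (continuousAt_cpow_const hs).continuousWithinAt
  by_cases h0 : z = 0
  · subst h0
    exact (continuousAt_cpow_const_of_re_pos (Or.inl le_rfl) (by simpa using hσ)).continuousWithinAt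
  have him : z.im = 0 := by
    by_contra h; exact hs (Or.inr h)
  have hre : z.re < 0 := by
    rcases lt_trichotomy z.re 0 with h | h | h
    · exact h
    · exact absurd (Complex.ext h him) h0
    · exact absurd (Or.inl h) hs
  have h1 : ContinuousWithinAt (fun z : ℂ => exp (log z * σ)) {z | 0 ≤ z.im} z :=
    ((continuousWithinAt_log_of_re_neg_of_im_zero hre him).mul continuousWithinAt_const).cexp
  refine h1.congr_of_eventuallyEq ?_ (cpow_def_of_ne_zero h0 _)
  exact ((eventually_ne_nhds h0).filter_mono nhdsWithin_le_nhds).mono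
    fun w hw => cpow_def_of_ne_zero hw _

/-- The integrand of the Gamma function along the Hankel contour. -/
noncomputable def gammaIntegrand (a σ : ℝ) (z : ℂ) : ℂ := z ^ ((σ - 1 : ℝ) : ℂ) * exp (a * z)

lemma measurable_gammaIntegrand : Measurable (gammaIntegrand a σ) := by
  unfold gammaIntegrand; fun_prop

lemma exists_norm_gammaIntegrand_le (hc : 0 < c) (hη : 0 < η) (ha : 0 < a) :
    ∃ C : ℝ, 0 ≤ C ∧ ∀ z ∈ hankelRegion c η,
      ‖gammaIntegrand a σ z‖ ≤ C * Real.exp (a / 2 * z.re) := by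
  obtain ⟨C, hC, h⟩ := exists_exp_log_mul_cpow_bound hc hη (σ - 1 : ℝ) le_rfl ha
    (C₀ := 1) (h := fun z => exp (a * z)) (fun z _ => by simp [norm_exp])
  refine ⟨C, hC, fun z hz => ?_⟩
  have := h z hz
  rwa [zero_mul, Real.exp_zero, one_mul, ← cpow_eq_exp_on_hankelRegion hc hη hz] at this

lemma continuousOn_gammaIntegrand_upper (hσ : 1 < σ) :
    ContinuousOn (gammaIntegrand a σ) {z | 0 ≤ z.im} :=
  (continuousOn_cpow_ofReal_upper (by linarith)).mul (by fun_prop)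

lemma integrableOn_gammaIntegrand_line (hc : 0 < c) (hη : 0 < η) (ha : 0 < a) (hσ : 1 < σ) {v : ℝ}
    (hv0 : 0 ≤ v) (hv : v ≤ η) :
    IntegrableOn (fun u : ℝ => gammaIntegrand a σ (u + v * I)) (Set.Iic c) := by
  -- For `u ≤ -c` the exponential bound away from `0` applies. The remaining compact piece may pass
  -- through `0`, where continuity is used.
  have hU : Set.Iic c = Set.Iic (-c) ∪ Set.Icc (-c) c := by
    rw [Set.Iic_union_Icc_eq_Iic (by linarith)]
  rw [hU, integrableOn_union]
  constructor
  · obtain ⟨C, -, hC⟩ := exists_norm_gammaIntegrand_le (σ := σ) hc hη ha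
    refine ((integrableOn_exp_mul_Iic (half_pos ha) (-c)).const_mul C).mono'
      (measurable_gammaIntegrand.comp (by fun_prop)).aestronglyMeasurable
      ((ae_restrict_mem measurableSet_Iic).mono fun u hu => ?_)
    have hu' : u ≤ -c := hu
    have := hC (u + v * I) ⟨(min_le_left _ _).trans (le_trans ?_ (abs_re_le_norm _)), ?_, ?_⟩
    · simpa using this
    · simpa using le_abs.2 (Or.inr (by linarith))
    · simp; linarith
    · simpa [abs_of_nonneg hv0] using hv
  · refine ContinuousOn.integrableOn_Icc ?_
    exact (continuousOn_gammaIntegrand_upper hσ).comp (by fun_prop) fun u _ => by simpa using hv0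

/-- The upper half of the contour can be pushed down to the real axis. -/
lemma gammaIntegrand_upper_contour (hc : 0 < c) (hη : 0 < η) (ha : 0 < a) (hσ : 1 < σ) :
    (∫ u in Set.Iic c, gammaIntegrand a σ (u + η * I))
      - I * (∫ v in (0 : ℝ)..η, gammaIntegrand a σ (c + v * I))
      = ∫ u in Set.Iic c, gammaIntegrand a σ (u : ℂ) := by
  -- Cauchy's theorem in the form that asks only for continuity on the closed rectangle, as its
  -- lower side runs along the cut.
  have hrect : ∀ R : ℝ,
      (∫ x in (-R)..c, gammaIntegrand a σ (x : ℂ))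
        - (∫ x in (-R)..c, gammaIntegrand a σ (x + η * I))
        + I * (∫ y in (0 : ℝ)..η, gammaIntegrand a σ (c + y * I))
        - I * (∫ y in (0 : ℝ)..η, gammaIntegrand a σ ((-R : ℝ) + y * I)) = 0 := by
    intro R
    have := integral_boundary_rect_eq_zero_of_continuousOn_of_differentiableOn
      (gammaIntegrand a σ) ((-R : ℝ) : ℂ) (c + η * I) ?_ ?_
    · simpa using this
    · refine (continuousOn_gammaIntegrand_upper hσ).mono fun z hz => ?_
      have := (mem_reProdIm.1 hz).2
      simp only [ofReal_im, add_im, mul_im, ofReal_re, I_im, I_re, mul_one, mul_zero, add_zero,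
        zero_add, Set.uIcc_of_le hη.le] at this
      exact this.1
    · intro z hz
      have := (mem_reProdIm.1 hz).2
      simp only [ofReal_im, add_im, mul_im, ofReal_re, I_im, I_re, mul_one, mul_zero, add_zero,
        zero_add, min_eq_left hη.le] at this
      have hz0 : z ∈ slitPlane := Or.inr this.1.ne'
      have h1 : DifferentiableAt ℂ (fun z : ℂ => z ^ ((σ - 1 : ℝ) : ℂ)) z :=
        differentiableAt_id.cpow_const hz0
      exact (h1.mul (by fun_prop)).differentiableWithinAt
  have hleft : Tendsto (fun R : ℝ =>
      ∫ y in (0 : ℝ)..η, gammaIntegrand a σ ((-R : ℝ) + y * I)) atTop (𝓝 0) := by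
    obtain ⟨C, -, hC⟩ := exists_norm_gammaIntegrand_le (σ := σ) hc hη ha
    have hlim : Tendsto (fun R : ℝ => C * Real.exp (a / 2 * -R) * |η - 0|) atTop (𝓝 0) := by
      have h1 : Tendsto (fun R : ℝ => a / 2 * -R) atTop atBot :=
        tendsto_neg_atTop_atBot.const_mul_atBot (half_pos ha)
      simpa using ((Real.tendsto_exp_atBot.comp h1).const_mul C).mul_const |η - 0|
    refine squeeze_zero_norm' ?_ hlim
    filter_upwards [eventually_ge_atTop c] with R hR
    refine intervalIntegral.norm_integral_le_of_norm_le_const fun y hy => ?_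
    rw [Set.uIoc_of_le hη.le] at hy
    have := hC ((-R : ℝ) + y * I)
      ⟨(min_le_left _ _).trans (le_trans ?_ (abs_re_le_norm _)), ?_, ?_⟩
    · simpa using this
    · simpa using le_abs.2 (Or.inl hR)
    · simp; linarith
    · simpa [abs_of_nonneg hy.1.le] using hy.2
  have hint0 : IntegrableOn (fun u : ℝ => gammaIntegrand a σ (u : ℂ)) (Set.Iic c) := by
    simpa using integrableOn_gammaIntegrand_line hc hη ha hσ le_rfl hη.le
  have h0 := intervalIntegral_tendsto_integral_Iic c hint0 tendsto_neg_atTop_atBot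
  have h1 := intervalIntegral_tendsto_integral_Iic c
    (integrableOn_gammaIntegrand_line hc hη ha hσ hη.le le_rfl) tendsto_neg_atTop_atBot
  have := (((h0.sub h1).add_const
    (I * (∫ y in (0 : ℝ)..η, gammaIntegrand a σ (c + y * I)))).sub (hleft.const_mul I))
  have h2 := tendsto_nhds_unique (this.congr fun R => hrect R) tendsto_const_nhds
  linear_combination -h2

lemma gammaIntegrand_conj {z : ℂ} (hz : z ∈ slitPlane) :
    gammaIntegrand a σ ((starRingEnd ℂ) z) = (starRingEnd ℂ) (gammaIntegrand a σ z) := by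
  unfold gammaIntegrand
  rw [conj_cpow _ _ (mem_slitPlane_iff_arg.1 hz).1, map_mul, ← exp_conj, map_mul, conj_ofReal,
    conj_ofReal]

/-- With real `a` and `σ`, conjugation exchanges the two halves of the contour, so only the upper
half has to be pushed to the axis. -/
lemma hankelIntegral_gammaIntegrand_eq_conj_sub (hc : 0 < c) (hη : 0 < η) (ha : 0 < a)
    (hσ : 1 < σ) :
    hankelIntegral c η (gammaIntegrand a σ)
      = (starRingEnd ℂ) (∫ u in Set.Iic c, gammaIntegrand a σ (u : ℂ))
        - ∫ u in Set.Iic c, gammaIntegrand a σ (u : ℂ) := by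
  have hlow : ∫ u in Set.Iic c, gammaIntegrand a σ (u - η * I)
      = (starRingEnd ℂ) (∫ u in Set.Iic c, gammaIntegrand a σ (u + η * I)) := by
    rw [← integral_conj]
    refine integral_congr_ae (ae_of_all _ fun u => ?_)
    simp only
    rw [← gammaIntegrand_conj (Or.inr (by simpa using hη.ne'))]
    congr 1
    simp [sub_eq_add_neg]
  have hside : ∫ v in (-η)..0, gammaIntegrand a σ (c + v * I)
      = (starRingEnd ℂ) (∫ v in (0 : ℝ)..η, gammaIntegrand a σ (c + v * I)) := by
    have h1 := intervalIntegral.integral_comp_neg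
      (fun v : ℝ => gammaIntegrand a σ (c + v * I)) (a := 0) (b := η)
    rw [neg_zero] at h1
    rw [← h1, intervalIntegral.integral_of_le hη.le, intervalIntegral.integral_of_le hη.le,
      ← integral_conj]
    refine integral_congr_ae (ae_of_all _ fun v => ?_)
    simp only
    rw [← gammaIntegrand_conj (Or.inl (by simpa using hc))]
    congr 1
    simp
  have hcont : Continuous fun v : ℝ => gammaIntegrand a σ (c + v * I) := by
    unfold gammaIntegrand
    refine Continuous.mul (continuous_iff_continuousAt.2 fun v => ?_) (by fun_prop)
    exact ContinuousAt.comp (f := fun v : ℝ => (c : ℂ) + v * I)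
      (continuousAt_cpow_const (Or.inl (by simpa using hc))) (by fun_prop)
  rw [← gammaIntegrand_upper_contour hc hη ha hσ]
  unfold hankelIntegral
  rw [hlow, ← intervalIntegral.integral_add_adjacent_intervals (b := 0)
    (hcont.intervalIntegrable _ _) (hcont.intervalIntegrable _ _), hside]
  simp only [map_sub, map_mul, conj_I]
  ring

lemma integral_gammaIntegrand_neg_axis (ha : 0 < a) (hσ : 1 < σ) :
    ∫ u in Set.Iic (0 : ℝ), gammaIntegrand a σ (u : ℂ)
      = exp (Real.pi * (σ - 1 : ℝ) * I) * (((1 / a) ^ σ * Real.Gamma σ : ℝ) : ℂ) := by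
  have h1 := integral_comp_neg_Ioi (0 : ℝ) (fun u : ℝ => gammaIntegrand a σ (u : ℂ))
  rw [neg_zero] at h1
  rw [← h1, ← Real.integral_rpow_mul_exp_neg_mul_Ioi (by linarith) ha, ← integral_complex_ofReal,
    ← integral_const_mul]
  refine setIntegral_congr_fun measurableSet_Ioi fun r hr => ?_
  have hr0 : (0 : ℝ) < r := hr
  simp only [gammaIntegrand]
  rw [ofReal_cpow_of_nonpos (by linarith)]
  simp only [ofReal_neg, neg_neg, ofReal_mul, ofReal_exp, mul_neg]
  rw [ofReal_cpow hr0.le]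
  ring_nf

/-- The integrand is real on `(0, c]`. On the negative axis its phase is `exp (π (σ - 1) I)` and its
modulus gives Euler's integral. -/
lemma im_integral_gammaIntegrand (hc : 0 < c) (ha : 0 < a) (hσ : 1 < σ) :
    (∫ u in Set.Iic c, gammaIntegrand a σ (u : ℂ)).im
      = -(Real.sin (Real.pi * σ) * ((1 / a) ^ σ * Real.Gamma σ)) := by
  have hint : IntegrableOn (fun u : ℝ => gammaIntegrand a σ (u : ℂ)) (Set.Iic c) := by
    simpa using integrableOn_gammaIntegrand_line hc hc ha hσ le_rfl hc.le
  have hU : Set.Iic c = Set.Iic 0 ∪ Set.Ioc 0 c := by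
    rw [Set.Iic_union_Ioc_eq_Iic hc.le]
  have hpos : (∫ u in Set.Ioc 0 c, gammaIntegrand a σ (u : ℂ)).im = 0 := by
    have : ∫ u in Set.Ioc 0 c, gammaIntegrand a σ (u : ℂ)
        = ((∫ u in Set.Ioc 0 c, u ^ (σ - 1) * Real.exp (a * u) : ℝ) : ℂ) := by
      rw [← integral_complex_ofReal]
      refine setIntegral_congr_fun measurableSet_Ioc fun u hu => ?_
      simp [gammaIntegrand, ofReal_cpow hu.1.le]
    rw [this, ofReal_im]
  have hd : Disjoint (Set.Iic (0 : ℝ)) (Set.Ioc 0 c) :=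
    Set.disjoint_left.2 fun u hu hu' => absurd hu'.1 (not_lt.2 hu)
  rw [hU] at hint ⊢
  rw [setIntegral_union hd measurableSet_Ioc (integrableOn_union.1 hint).1 (integrableOn_union.1 hint).2, add_im, hpos,
    integral_gammaIntegrand_neg_axis ha hσ, im_mul_ofReal, ← ofReal_mul, exp_ofReal_mul_I_im,
    mul_sub, mul_one, Real.sin_sub_pi]
  ring

lemma hankelIntegral_gammaIntegrand (hc : 0 < c) (hη : 0 < η) (ha : 0 < a) (hσ : 1 < σ) :
    hankelIntegral c η (gammaIntegrand a σ)
      = 2 * Real.pi * I * (a : ℂ) ^ (-σ : ℂ) * (Gamma (1 - σ))⁻¹ := by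
  set B := ∫ u in Set.Iic c, gammaIntegrand a σ (u : ℂ) with hB
  have h1 : hankelIntegral c η (gammaIntegrand a σ) = -(2 * I * (B.im : ℂ)) := by
    rw [hankelIntegral_gammaIntegrand_eq_conj_sub hc hη ha hσ, ← hB]
    apply Complex.ext <;> simp
    ring
  have h2 : Real.sin (Real.pi * σ) * Real.Gamma σ = Real.pi * (Real.Gamma (1 - σ))⁻¹ := by
    have hG : Real.Gamma σ ≠ 0 := (Real.Gamma_pos_of_pos (by linarith)).ne'
    have h := Real.Gamma_mul_Gamma_one_sub σ
    -- At integers the reflection formula reads `Γ(σ) Γ(1-σ) = π / 0 = 0`. This gives `Γ(1-σ) = 0`,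
    -- whose inverse is `0`, so both sides vanish.
    by_cases hs : Real.sin (Real.pi * σ) = 0
    · rw [hs, div_zero] at h
      rw [hs, (mul_eq_zero.1 h).resolve_left hG]
      simp
    · have hG' : Real.Gamma (1 - σ) ≠ 0 := by
        intro h0
        rw [h0, mul_zero] at h
        exact (div_ne_zero Real.pi_ne_zero hs) h.symm
      rw [eq_div_iff hs] at h
      rw [← div_eq_mul_inv, eq_div_iff hG']
      linear_combination h
  have h3 : (a : ℂ) ^ (-σ : ℂ) = (((1 / a) ^ σ : ℝ) : ℂ) := by
    rw [one_div, Real.inv_rpow ha.le, ← Real.rpow_neg ha.le, ofReal_cpow ha.le, ofReal_neg]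
  have h4 : (Gamma (1 - σ))⁻¹ = (((Real.Gamma (1 - σ))⁻¹ : ℝ) : ℂ) := by
    rw [ofReal_inv, ← Gamma_ofReal]; simp
  rw [h1, hB, im_integral_gammaIntegrand hc ha hσ, h3, h4]
  have h5 := congrArg (fun x : ℝ => (x : ℂ)) h2
  simp only [ofReal_mul] at h5
  push_cast at h5 ⊢
  linear_combination (2 * I * ((1 / a : ℂ) ^ (σ : ℂ) * 0 + (((1 / a) ^ σ : ℝ) : ℂ))) * h5

end RealParameters

/-! ### Hankel's formula for complex parameters, and its derivative at positive integers. -/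

/-- Identity theorem for analytic functions that agree on real numbers to the right of a point. -/
lemma eqOn_of_eq_ofReal {f g : ℂ → ℂ} {U : Set ℂ} (hf : AnalyticOnNhd ℂ f U)
    (hg : AnalyticOnNhd ℂ g U) (hU : IsPreconnected U) {x₀ : ℝ} (hx : (x₀ : ℂ) ∈ U)
    (h : ∀ r : ℝ, x₀ < r → f r = g r) : Set.EqOn f g U := by
  refine hf.eqOn_of_preconnected_of_frequently_eq hg hU hx ?_
  have h1 : Tendsto (fun r : ℝ => (r : ℂ)) (𝓝[>] x₀) (𝓝[≠] (x₀ : ℂ)) := by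
    refine tendsto_nhdsWithin_iff.2 ⟨?_, ?_⟩
    · exact continuous_ofReal.continuousAt.tendsto.mono_left nhdsWithin_le_nhds
    · filter_upwards [self_mem_nhdsWithin] with r hr
      simpa using (ne_of_gt hr : r ≠ x₀)
  refine h1.frequently (Eventually.frequently ?_)
  filter_upwards [self_mem_nhdsWithin] with r hr using h r hr

lemma norm_hankelDir_mul_exp_le {c η : ℝ} (a : ℂ) :
    ∀ z ∈ hankelRegion c η, ‖hankelDir η z * exp (a * z)‖
      ≤ Real.exp (‖a‖ * η) * Real.exp (a.re * z.re) := fun z hz => by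
  rw [norm_mul, norm_hankelDir, one_mul]
  exact norm_exp_mul_re a z hz

lemma measurable_hankelDir_mul_exp (η : ℝ) (a : ℂ) :
    Measurable fun z => hankelDir η z * exp (a * z) :=
  (measurable_hankelDir η).mul (by fun_prop)

/-- Both sides are entire in `s` and agree for real `s > 1`. -/
lemma integral_hankelMeasure_cpow_mul_exp_ofReal {c η a : ℝ} (hc : 0 < c) (hη : 0 < η)
    (ha : 0 < a) (s : ℂ) :
    ∫ z, z ^ (s - 1) * (hankelDir η z * exp (a * z)) ∂hankelMeasure c η
      = 2 * Real.pi * I * (a : ℂ) ^ (-s) * (Gamma (1 - s))⁻¹ := by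
  have hL : Differentiable ℂ fun s : ℂ =>
      ∫ z, z ^ (s - 1) * (hankelDir η z * exp (a * z)) ∂hankelMeasure c η := fun s =>
    (hasDerivAt_integral_cpow_mul hc hη s (b := (a : ℂ).re) (by simpa using ha)
      (measurable_hankelDir_mul_exp η a) (norm_hankelDir_mul_exp_le a)).2.differentiableAt
  have hR : Differentiable ℂ fun s : ℂ =>
      2 * Real.pi * I * (a : ℂ) ^ (-s) * (Gamma (1 - s))⁻¹ := by
    have ha0 : (a : ℂ) ≠ 0 := by exact_mod_cast ha.ne'
    have h1 : Differentiable ℂ fun s : ℂ => (a : ℂ) ^ (-s) := fun s =>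
      DifferentiableAt.const_cpow (by fun_prop) (Or.inl ha0)
    have h2 : Differentiable ℂ fun s : ℂ => (Gamma (1 - s))⁻¹ :=
      differentiable_one_div_Gamma.comp (by fun_prop)
    exact ((differentiable_const _).mul h1).mul h2
  refine eqOn_of_eq_ofReal (hL.differentiableOn.analyticOnNhd isOpen_univ)
    (hR.differentiableOn.analyticOnNhd isOpen_univ) isPreconnected_univ (x₀ := 1)
    (Set.mem_univ _) (fun σ hσ => ?_) (Set.mem_univ s)
  have hint : Integrable (gammaIntegrand a σ) (hankelMeasure c η) := by
    obtain ⟨C, _, hC⟩ := exists_norm_gammaIntegrand_le (σ := σ) hc hη ha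
    exact integrable_of_norm_le_exp hc hη measurable_gammaIntegrand (half_pos ha) hC
  have h1 := hankelIntegral_gammaIntegrand hc hη ha hσ
  rw [hankelIntegral_eq hη hint] at h1
  rw [← h1]
  refine integral_congr_ae (ae_of_all _ fun z => ?_)
  simp only [gammaIntegrand]
  push_cast
  ring

/-- **Hankel's formula** for the reciprocal Gamma function, with a complex scale `a`. -/
lemma integral_hankelMeasure_cpow_mul_exp {c η : ℝ} (hc : 0 < c) (hη : 0 < η) {a : ℂ}
    (ha : 0 < a.re) (s : ℂ) :
    ∫ z, z ^ (s - 1) * (hankelDir η z * exp (a * z)) ∂hankelMeasure c η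
      = 2 * Real.pi * I * a ^ (-s) * (Gamma (1 - s))⁻¹ := by
  have hopen : IsOpen {a : ℂ | 0 < a.re} := isOpen_lt continuous_const continuous_re
  have hL : DifferentiableOn ℂ (fun a : ℂ =>
      ∫ z, z ^ (s - 1) * (hankelDir η z * exp (a * z)) ∂hankelMeasure c η) {a : ℂ | 0 < a.re} := by
    intro a ha
    have h := differentiableAt_integral_cpow_mul_exp hc hη (s - 1) ha (measurable_hankelDir η)
      (fun z _ => (norm_hankelDir η z).le)
    refine (h.congr_of_eventuallyEq (Eventually.of_forall fun b => ?_)).differentiableWithinAt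
    refine integral_congr_ae (ae_of_all _ fun z => ?_)
    simp only
    ring
  have hR : DifferentiableOn ℂ (fun a : ℂ =>
      2 * Real.pi * I * a ^ (-s) * (Gamma (1 - s))⁻¹) {a : ℂ | 0 < a.re} := by
    intro a ha
    have h1 : DifferentiableAt ℂ (fun a : ℂ => a ^ (-s)) a :=
      differentiableAt_id.cpow_const (Or.inl ha)
    exact ((h1.const_mul _).mul_const _).differentiableWithinAt
  refine eqOn_of_eq_ofReal (hL.analyticOnNhd hopen) (hR.analyticOnNhd hopen)
    (convex_halfSpace_re_gt 0).isPreconnected (x₀ := 1) (by simp) (fun r hr => ?_) ha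
  exact integral_hankelMeasure_cpow_mul_exp_ofReal hc hη (by linarith) s

/-- Induction through `1/Γ(s) = s / Γ(s+1)`. At `-(n+1)` the second factor vanishes, with the
conventions `Γ(-n) = 0` and `0⁻¹ = 0`, so each step multiplies the derivative by `-(n+1)`. -/
lemma hasDerivAt_Gamma_inv_neg_nat (n : ℕ) :
    HasDerivAt (fun s : ℂ => (Gamma s)⁻¹) ((-1) ^ n * (n.factorial : ℂ)) (-(n : ℂ)) := by
  have hfun : (fun s : ℂ => (Gamma s)⁻¹) = fun s => s * (Gamma (s + 1))⁻¹ := by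
    ext s; exact one_div_Gamma_eq_self_mul_one_div_Gamma_add_one s
  induction n with
  | zero =>
    have h1 : HasDerivAt (fun s : ℂ => (Gamma (s + 1))⁻¹)
        (deriv (fun s : ℂ => (Gamma (s + 1))⁻¹) 0) 0 :=
      (differentiable_one_div_Gamma.comp (differentiable_id.add_const 1)).differentiableAt.hasDerivAt
    have e : -((0 : ℕ) : ℂ) = 0 := by simp
    rw [hfun, e]
    exact ((hasDerivAt_id' (0 : ℂ)).mul h1).congr_deriv (by simp)
  | succ n ih =>
    have e : -((n + 1 : ℕ) : ℂ) + 1 = -(n : ℂ) := by push_cast; ring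
    have h1 : HasDerivAt (fun s : ℂ => (Gamma (s + 1))⁻¹) ((-1) ^ n * (n.factorial : ℂ))
        (-((n + 1 : ℕ) : ℂ)) :=
      HasDerivAt.comp_add_const (f := fun s : ℂ => (Gamma s)⁻¹) _ 1 (by rw [e]; exact ih)
    rw [hfun]
    refine ((hasDerivAt_id' _).mul h1).congr_deriv ?_
    rw [e, Gamma_neg_nat_eq_zero, Nat.factorial_succ]
    push_cast
    ring

lemma hasDerivAt_Gamma_one_sub_inv {m : ℕ} (hm : 1 ≤ m) :
    HasDerivAt (fun s : ℂ => (Gamma (1 - s))⁻¹) ((-1) ^ m * ((m - 1).factorial : ℂ)) (m : ℂ) := by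
  obtain ⟨n, rfl⟩ : ∃ n, m = n + 1 := ⟨m - 1, by omega⟩
  have e : 1 - ((n + 1 : ℕ) : ℂ) = -(n : ℂ) := by push_cast; ring
  have h := hasDerivAt_Gamma_inv_neg_nat n
  rw [← e] at h
  have h2 := HasDerivAt.comp_const_sub (f := fun s : ℂ => (Gamma s)⁻¹) 1 _ h
  refine h2.congr_deriv ?_
  rw [Nat.add_sub_cancel, pow_succ]
  ring

lemma Gamma_one_sub_natCast {m : ℕ} (hm : 1 ≤ m) : Gamma (1 - (m : ℂ)) = 0 := by
  obtain ⟨n, rfl⟩ : ∃ n, m = n + 1 := ⟨m - 1, by omega⟩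
  have e : 1 - ((n + 1 : ℕ) : ℂ) = -(n : ℂ) := by push_cast; ring
  rw [e, Gamma_neg_nat_eq_zero]

/-- The logarithmic variant of Hankel's formula at positive integers. -/
lemma integral_hankelMeasure_log_mul_cpow_mul_exp {c η : ℝ} (hc : 0 < c) (hη : 0 < η) {a : ℂ}
    (ha : 0 < a.re) {m : ℕ} (hm : 1 ≤ m) :
    ∫ z, log z * z ^ ((m : ℂ) - 1) * (hankelDir η z * exp (a * z)) ∂hankelMeasure c η
      = 2 * Real.pi * I * a ^ (-(m : ℂ)) * ((-1) ^ m * ((m - 1).factorial : ℂ)) := by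
  have ha0 : a ≠ 0 := by rintro rfl; simp at ha
  have h1 := (hasDerivAt_integral_cpow_mul hc hη (m : ℂ) ha
    (measurable_hankelDir_mul_exp η a) (norm_hankelDir_mul_exp_le a)).2
  -- This derivative stays unevaluated: the product rule multiplies it by `1/Γ(1-m) = 0`.
  have h2 : HasDerivAt (fun s : ℂ => 2 * Real.pi * I * a ^ (-s))
      (deriv (fun s : ℂ => 2 * Real.pi * I * a ^ (-s)) m) m := by
    refine DifferentiableAt.hasDerivAt ?_
    exact (DifferentiableAt.const_cpow (by fun_prop) (Or.inl ha0)).const_mul _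
  have h3 := h2.mul (hasDerivAt_Gamma_one_sub_inv hm)
  rw [Gamma_one_sub_natCast hm, inv_zero, mul_zero, zero_add] at h3
  refine h1.unique (h3.congr_of_eventuallyEq (Eventually.of_forall fun s => ?_))
  exact integral_hankelMeasure_cpow_mul_exp hc hη ha s

/-- If `X` and `q` vanish at `m`, then `X / q` tends to the quotient of the derivatives. -/
lemma tendsto_div_of_hasDerivAt {X q : ℂ → ℂ} {X' q' m : ℂ} (hX : HasDerivAt X X' m)
    (hq : HasDerivAt q q' m) (hX0 : X m = 0) (hq0 : q m = 0) (hq' : q' ≠ 0) :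
    Tendsto (fun s => X s / q s) (𝓝[≠] m) (𝓝 (X' / q')) := by
  refine ((hasDerivAt_iff_tendsto_slope.1 hX).div (hasDerivAt_iff_tendsto_slope.1 hq) hq').congr' ?_
  filter_upwards [self_mem_nhdsWithin] with s hs
  have : s - m ≠ 0 := sub_ne_zero.2 hs
  simp only [slope_def_field, hX0, hq0, sub_zero, Pi.div_apply]
  field_simp

/-! ### The degenerate exponential, its domain and its binomial series. -/

lemma isOpen_degExpDomain (lam : ℝ) : IsOpen (degExpDomain lam) := by
  have h1 : IsOpen {y : ℂ | 1 + (lam : ℂ) * y ∈ slitPlane} :=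
    isOpen_slitPlane.preimage (by fun_prop)
  by_cases hN : ∃ N : ℕ, lam * (N : ℝ) = 1
  · simp [degExpDomain, hN]
  · simpa [degExpDomain, hN] using h1

lemma zero_mem_degExpDomain (lam : ℝ) : (0 : ℂ) ∈ degExpDomain lam := by
  left; simp

/-- The slit plane is star-shaped about `1`, and `1 + λ r y` lies on the segment from `1` to `1 + λ
y`. -/
lemma ofReal_mul_mem_degExpDomain {lam : ℝ} {y : ℂ} (hy : y ∈ degExpDomain lam) {r : ℝ}
    (h0 : 0 ≤ r) (h1 : r ≤ 1) : (r : ℂ) * y ∈ degExpDomain lam := by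
  rcases hy with hy | hy
  · left
    have := starConvex_one_slitPlane.add_smul_mem hy h0 h1
    rw [real_smul] at this
    convert this using 1
    ring
  · exact Or.inr hy

lemma mem_degExpDomain_of_norm_lt {lam : ℝ} {y : ℂ} (hy : ‖(lam : ℂ) * y‖ < 1) :
    y ∈ degExpDomain lam :=
  Or.inl (mem_slitPlane_of_norm_lt_one hy)

lemma measurable_degExp (lam : ℝ) : Measurable (degExp lam) := by
  unfold degExp; fun_prop

lemma differentiableOn_degExp {lam : ℝ} :
    DifferentiableOn ℂ (degExp lam) (degExpDomain lam) := by
  by_cases hN : ∃ N : ℕ, lam * (N : ℝ) = 1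
  · obtain ⟨N, hN⟩ := hN
    have h0 : lam ≠ 0 := by rintro rfl; simp at hN
    have e : (1 / (lam : ℂ)) = (N : ℂ) := by
      rw [div_eq_iff (by exact_mod_cast h0)]
      have : ((lam * N : ℝ) : ℂ) = 1 := by rw [hN]; simp
      push_cast at this
      rw [← this]; ring
    have : degExp lam = fun y => (1 + (lam : ℂ) * y) ^ N := by
      ext y; rw [degExp, e, cpow_natCast]
    rw [this]
    fun_prop
  · intro y hy
    have hy' : 1 + (lam : ℂ) * y ∈ slitPlane := hy.resolve_right hN
    have : DifferentiableAt ℂ (fun y : ℂ => 1 + (lam : ℂ) * y) y := by fun_prop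
    exact (this.cpow_const hy').differentiableWithinAt

lemma ofReal_degFalling_one {lam : ℝ} (hlam : lam ≠ 0) (n : ℕ) :
    (degFalling lam 1 n : ℂ) / (n.factorial : ℂ)
      = Ring.choose (1 / (lam : ℂ)) n * (lam : ℂ) ^ n := by
  have hl : (lam : ℂ) ≠ 0 := by exact_mod_cast hlam
  have h1 : ∀ (r : ℂ) (n : ℕ), Polynomial.aeval r (descPochhammer ℤ n)
      = ∏ k ∈ Finset.range n, (r - k) := by
    intro r n
    induction n with
    | zero => simp
    | succ n ih => rw [descPochhammer_succ_right, map_mul, ih, Finset.prod_range_succ]; simp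
  have h2 := Ring.descPochhammer_eq_factorial_smul_choose (1 / (lam : ℂ)) n
  rw [← Polynomial.aeval_eq_smeval, h1, nsmul_eq_mul] at h2
  rw [div_eq_iff (by exact_mod_cast n.factorial_ne_zero)]
  have h3 : (degFalling lam 1 n : ℂ)
      = (∏ k ∈ Finset.range n, (1 / (lam : ℂ) - k)) * (lam : ℂ) ^ n := by
    have : (lam : ℂ) ^ n = ∏ _k ∈ Finset.range n, (lam : ℂ) := by simp
    rw [this, ← Finset.prod_mul_distrib, degFalling, ofReal_prod]
    refine Finset.prod_congr rfl fun k _ => ?_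
    push_cast
    field_simp
  rw [h3, h2]
  ring

/-- The binomial series of the degenerate exponential. -/
lemma hasSum_degExp {lam : ℝ} (hlam : lam ≠ 0) {y : ℂ} (hy : ‖(lam : ℂ) * y‖ < 1) :
    HasSum (fun n : ℕ => (degFalling lam 1 n : ℂ) / (n.factorial : ℂ) * y ^ n)
      (degExp lam y) := by
  have h := (one_add_cpow_hasFPowerSeriesOnBall_zero (a := 1 / (lam : ℂ))).hasSum_sub
    (y := (lam : ℂ) * y) (by
      rw [Metric.mem_eball, edist_zero_right, ← ofReal_norm]
      exact ENNReal.ofReal_lt_one.2 hy)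
  refine h.congr_fun fun n => ?_
  rw [ofReal_degFalling_one hlam, binomialSeries_apply]
  simp only [sub_zero, List.ofFn_const, List.prod_replicate, smul_eq_mul]
  ring

lemma summable_norm_degExp_coeff {lam : ℝ} (hlam : lam ≠ 0) {r : ℝ} (hr0 : 0 ≤ r)
    (hr : |lam| * r < 1) :
    Summable fun n : ℕ => ‖(degFalling lam 1 n : ℂ) / (n.factorial : ℂ)‖ * r ^ n := by
  have := (hasSum_degExp hlam (y := (r : ℂ)) (by
    simpa [abs_of_nonneg hr0] using hr)).summable.norm
  simpa [abs_of_nonneg hr0] using this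

/-! ### Admissible points and contours. -/

/-- The compact sector filled by `exp t` for `t` in the half-strip, together with `0`. -/
noncomputable def expSector (c η : ℝ) : Set ℂ :=
  (fun p : ℝ × ℝ => (p.1 : ℂ) * exp (p.2 * I)) '' (Set.Icc 0 (Real.exp c) ×ˢ Set.Icc (-η) η)

lemma isCompact_expSector (c η : ℝ) : IsCompact (expSector c η) :=
  (isCompact_Icc.prod isCompact_Icc).image (by fun_prop)

lemma exp_mem_expSector {c η : ℝ} {z : ℂ} (h1 : z.re ≤ c) (h2 : |z.im| ≤ η) :
    exp z ∈ expSector c η := by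
  refine ⟨(Real.exp z.re, z.im), ⟨⟨(Real.exp_pos _).le, Real.exp_le_exp.2 h1⟩, abs_le.1 h2⟩, ?_⟩
  simp only
  rw [ofReal_exp, ← exp_add, re_add_im]

/-- The set of all `x` such that `x` times the sector lies in the domain of `degExp`. -/
def admissibleSet (lam c η : ℝ) : Set ℂ :=
  {x | ∀ k ∈ expSector c η, x * k ∈ degExpDomain lam}

lemma HankelAdmissible.mem_admissibleSet {lam : ℝ} {x : ℂ} {c η : ℝ}
    (h : HankelAdmissible lam x c η) : x ∈ admissibleSet lam c η := by
  rintro k ⟨⟨r, θ⟩, ⟨hr, hθ⟩, rfl⟩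
  rcases hr.1.eq_or_lt with h0 | h0
  · simp only at h0
    simp [← h0, zero_mem_degExpDomain]
  · have := h.2.2 (Real.log r + θ * I) ?_ ?_
    · rwa [exp_add, ← ofReal_exp, Real.exp_log h0] at this
    · simpa using (Real.log_le_iff_le_exp h0).2 hr.2
    · simpa using abs_le.2 hθ

/-- The tube lemma over the sector. Adding `0`, the limit of `exp t` as `Re t → -∞`, is what makes
the sector compact. -/
lemma isOpen_admissibleSet (lam c η : ℝ) : IsOpen (admissibleSet lam c η) := by
  refine isOpen_iff_eventually.2 fun x hx => ?_
  refine (isCompact_expSector c η).eventually_forall_of_forall_eventually fun k hk => ?_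
  exact ((isOpen_degExpDomain lam).preimage (by fun_prop :
    Continuous fun p : ℂ × ℂ => p.1 * p.2)).mem_nhds (hx k hk)

lemma zero_mem_admissibleSet (lam c η : ℝ) : (0 : ℂ) ∈ admissibleSet lam c η := fun k _ => by
  rw [zero_mul]; exact zero_mem_degExpDomain lam

lemma ofReal_mul_mem_admissibleSet {lam c η : ℝ} {x : ℂ} (hx : x ∈ admissibleSet lam c η) {r : ℝ}
    (h0 : 0 ≤ r) (h1 : r ≤ 1) : (r : ℂ) * x ∈ admissibleSet lam c η := fun k hk => by
  rw [mul_assoc]; exact ofReal_mul_mem_degExpDomain (hx k hk) h0 h1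

lemma isPreconnected_of_star {S : Set ℂ} (h0 : (0 : ℂ) ∈ S)
    (h : ∀ x ∈ S, ∀ r : ℝ, 0 ≤ r → r ≤ 1 → (r : ℂ) * x ∈ S) : IsPreconnected S := by
  have : StarConvex ℝ 0 S := starConvex_zero_iff.2 fun x hx r hr0 hr1 => by
    rw [real_smul]; exact h x hx r hr0 hr1
  exact (this.isPathConnected h0).isConnected.isPreconnected

/-- Write `exp t = r * exp τ` with `τ = c + i Im t` near `0` and `r = exp (Re t - c) ≤ 1`.
Star-shapedness handles `r`, and the tube lemma over `[0, 1]` makes the smallness of `τ` uniform. -/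
lemma exists_admissible {lam : ℝ} {x : ℂ} (hx : x ∈ degExpDomain lam) :
    ∃ ρ : ℝ, 0 < ρ ∧
      ∀ c η : ℝ, 0 < c → c < ρ → 0 < η → η < ρ → HankelAdmissible lam x c η := by
  have h1 : ∀ᶠ τ in 𝓝 (0 : ℂ), ∀ r ∈ Set.Icc (0 : ℝ) 1,
      (r : ℂ) * (x * exp τ) ∈ degExpDomain lam := by
    refine isCompact_Icc.eventually_forall_of_forall_eventually fun r hr => ?_
    refine ((isOpen_degExpDomain lam).preimage (by fun_prop :
      Continuous fun p : ℂ × ℝ => (p.2 : ℂ) * (x * exp p.1))).mem_nhds ?_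
    simpa using ofReal_mul_mem_degExpDomain hx hr.1 hr.2
  obtain ⟨ε, hε, h2⟩ := Metric.eventually_nhds_iff.1 h1
  refine ⟨ε / 2, half_pos hε, fun c η hc hcρ hη hηρ => ⟨hc, hη, fun t ht1 ht2 => ?_⟩⟩
  have h3 := h2 (y := (c : ℂ) + t.im * I) ?_ (Real.exp (t.re - c))
    ⟨(Real.exp_pos _).le, Real.exp_le_one_iff.2 (by linarith)⟩
  · convert h3 using 1
    rw [ofReal_exp, mul_left_comm, ← exp_add]
    congr 2
    conv_lhs => rw [← re_add_im t]
    push_cast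
    ring
  · rw [dist_zero_right]
    refine (norm_add_le _ _).trans_lt ?_
    simp only [norm_mul, norm_real, norm_I, mul_one, Real.norm_eq_abs, abs_of_pos hc]
    linarith

/-! ### Integrals of `κ(z) e_λ(x e^z)` as functions of `x`. -/

section ParametricIntegral

variable {lam c η : ℝ} {κ : ℂ → ℂ}

lemma ae_exp_mem_expSector (hc : 0 < c) (hη : 0 < η) :
    ∀ᵐ z ∂hankelMeasure c η, exp z ∈ expSector c η :=
  (ae_hankelMeasure hc hη).mono fun _ hz => exp_mem_expSector hz.2.1 hz.2.2

/-- A small closed ball times the sector is a compact subset of the domain. The bound is used for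
`degExp` and for its derivative. -/
lemma exists_bound_mul_expSector {f : ℂ → ℂ} (hf : ContinuousOn f (degExpDomain lam)) {x₀ : ℂ}
    (hx : x₀ ∈ admissibleSet lam c η) :
    ∃ ε : ℝ, 0 < ε ∧ Metric.closedBall x₀ ε ⊆ admissibleSet lam c η ∧ ∃ C : ℝ, 0 ≤ C ∧
      ∀ x ∈ Metric.closedBall x₀ ε, ∀ k ∈ expSector c η, ‖f (x * k)‖ ≤ C := by
  obtain ⟨ε, hε, h1⟩ := Metric.nhds_basis_closedBall.mem_iff.1
    ((isOpen_admissibleSet lam c η).mem_nhds hx)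
  have hcomp : IsCompact ((fun p : ℂ × ℂ => p.1 * p.2) ''
      (Metric.closedBall x₀ ε ×ˢ expSector c η)) :=
    ((isCompact_closedBall x₀ ε).prod (isCompact_expSector c η)).image (by fun_prop)
  obtain ⟨C, hC⟩ := hcomp.exists_bound_of_continuousOn (hf.mono (by
    rintro _ ⟨⟨x, k⟩, ⟨hx, hk⟩, rfl⟩
    exact h1 hx k hk))
  refine ⟨ε, hε, h1, |C|, abs_nonneg C, fun x hx k hk => ?_⟩
  exact (hC _ ⟨(x, k), ⟨hx, hk⟩, rfl⟩).trans (le_abs_self C)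

lemma integrable_mul_degExp (hc : 0 < c) (hη : 0 < η) (hκ : Integrable κ (hankelMeasure c η))
    {x : ℂ} (hx : x ∈ admissibleSet lam c η) :
    Integrable (fun z => κ z * degExp lam (x * exp z)) (hankelMeasure c η) := by
  obtain ⟨ε, hε, -, C, -, hC⟩ :=
    exists_bound_mul_expSector (differentiableOn_degExp.continuousOn) hx
  refine hκ.mul_bdd (c := C)
    ((measurable_degExp lam).comp (by fun_prop)).aestronglyMeasurable ?_
  exact (ae_exp_mem_expSector hc hη).mono fun z hz =>
    hC x (Metric.mem_closedBall_self hε.le) _ hz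

lemma differentiableOn_integral_mul_degExp (hc : 0 < c) (hη : 0 < η)
    (hκ : Integrable κ (hankelMeasure c η)) :
    DifferentiableOn ℂ (fun x => ∫ z, κ z * degExp lam (x * exp z) ∂hankelMeasure c η)
      (admissibleSet lam c η) := by
  intro x₀ hx₀
  have hD := isOpen_degExpDomain lam
  have hd : ContinuousOn (deriv (degExp lam)) (degExpDomain lam) :=
    ((differentiableOn_degExp.analyticOnNhd hD).deriv).continuousOn
  obtain ⟨ε, hε, hsub, C, hC0, hC⟩ := exists_bound_mul_expSector hd hx₀
  have hmeas : ∀ x : ℂ, AEStronglyMeasurable (fun z => degExp lam (x * exp z))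
      (hankelMeasure c η) := fun x =>
    ((measurable_degExp lam).comp (by fun_prop)).aestronglyMeasurable
  refine DifferentiableAt.differentiableWithinAt ?_
  refine (hasDerivAt_integral_of_dominated_loc_of_deriv_le (Metric.ball_mem_nhds x₀ hε)
    (F := fun x z => κ z * degExp lam (x * exp z))
    (F' := fun x z => κ z * (deriv (degExp lam) (x * exp z) * exp z))
    (bound := fun z => ‖κ z‖ * (C * Real.exp c))
    (Eventually.of_forall fun x => hκ.aestronglyMeasurable.mul (hmeas x))
    (integrable_mul_degExp hc hη hκ hx₀) ?_ ?_ (hκ.norm.mul_const _) ?_).2.differentiableAt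
  · refine hκ.aestronglyMeasurable.mul (Measurable.aestronglyMeasurable ?_)
    exact ((measurable_deriv _).comp (by fun_prop)).mul (by fun_prop)
  · filter_upwards [ae_hankelMeasure hc hη] with z hz x hx
    rw [norm_mul, norm_mul]
    gcongr
    · exact hC x (Metric.ball_subset_closedBall hx) _ (exp_mem_expSector hz.2.1 hz.2.2)
    · rw [norm_exp]; exact Real.exp_le_exp.2 hz.2.1
  · filter_upwards [ae_exp_mem_expSector hc hη] with z hz x hx
    have h1 : HasDerivAt (degExp lam) (deriv (degExp lam) (x * exp z)) (x * exp z) :=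
      (differentiableOn_degExp.differentiableAt (hD.mem_nhds
        (hsub (Metric.ball_subset_closedBall hx) _ hz))).hasDerivAt
    have h2 : HasDerivAt (fun x : ℂ => x * exp z) (exp z) x := by
      simpa using (hasDerivAt_id' x).mul_const (exp z)
    exact (h1.comp x h2).const_mul _

/-- Termwise integration of the binomial series. -/
lemma hasSum_integral_mul_degExp (hlam : lam ≠ 0) (hc : 0 < c) (hη : 0 < η)
    (hκ : Integrable κ (hankelMeasure c η)) {x : ℂ} (hx : ‖(lam : ℂ) * x‖ * Real.exp c < 1) :
    HasSum (fun n : ℕ => (degFalling lam 1 n : ℂ) / (n.factorial : ℂ) * x ^ n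
        * ∫ z, κ z * exp (n * z) ∂hankelMeasure c η)
      (∫ z, κ z * degExp lam (x * exp z) ∂hankelMeasure c η) := by
  have hsum := summable_norm_degExp_coeff hlam (r := ‖x‖ * Real.exp c) (by positivity) (by
    rw [norm_mul, norm_real, Real.norm_eq_abs] at hx
    linarith)
  have key := hasSum_integral_of_dominated_convergence (μ := hankelMeasure c η)
    (F := fun (n : ℕ) z => κ z * ((degFalling lam 1 n : ℂ) / (n.factorial : ℂ) * (x * exp z) ^ n))
    (f := fun z => κ z * degExp lam (x * exp z))
    (fun n z => ‖κ z‖ *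
      (‖(degFalling lam 1 n : ℂ) / (n.factorial : ℂ)‖ * (‖x‖ * Real.exp c) ^ n))
    (fun n => hκ.aestronglyMeasurable.mul (Measurable.aestronglyMeasurable (by fun_prop)))
    (fun n => ?_) (ae_of_all _ fun z => hsum.mul_left _) ?_ ?_
  · refine key.congr_fun fun n => ?_
    rw [← integral_const_mul]
    refine integral_congr_ae (ae_of_all _ fun z => ?_)
    simp only
    rw [mul_pow, ← exp_nat_mul]
    ring
  · filter_upwards [ae_hankelMeasure hc hη] with z hz
    rw [norm_mul, norm_mul, norm_pow, norm_mul, norm_exp]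
    gcongr
    exact hz.2.1
  · simp_rw [tsum_mul_left]
    exact hκ.norm.mul_const _
  · filter_upwards [ae_hankelMeasure hc hη] with z hz
    refine (hasSum_degExp hlam ?_).mul_left _
    rw [← mul_assoc, norm_mul, norm_exp]
    exact (mul_le_mul_of_nonneg_left (Real.exp_le_exp.2 hz.2.1) (norm_nonneg _)).trans_lt hx

lemma eventually_norm_mul_exp_lt (lam c : ℝ) :
    ∀ᶠ x in 𝓝 (0 : ℂ), ‖(lam : ℂ) * x‖ * Real.exp c < 1 := by
  have : Continuous fun x : ℂ => ‖(lam : ℂ) * x‖ * Real.exp c := by fun_prop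
  exact this.continuousAt.eventually_lt continuousAt_const (by simp)

/-- The integral only depends on the moments `∫ κ exp (n z)` of the kernel. -/
lemma integral_mul_degExp_eq_of_moments (hlam : lam ≠ 0) {c' η' : ℝ} {κ' : ℂ → ℂ} (hc : 0 < c)
    (hη : 0 < η) (hc' : 0 < c') (hη' : 0 < η') (hκ : Integrable κ (hankelMeasure c η))
    (hκ' : Integrable κ' (hankelMeasure c' η'))
    (h : ∀ n : ℕ, ∫ z, κ z * exp (n * z) ∂hankelMeasure c η
      = ∫ z, κ' z * exp (n * z) ∂hankelMeasure c' η') {x : ℂ}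
    (hx : x ∈ admissibleSet lam c η) (hx' : x ∈ admissibleSet lam c' η') :
    ∫ z, κ z * degExp lam (x * exp z) ∂hankelMeasure c η
      = ∫ z, κ' z * degExp lam (x * exp z) ∂hankelMeasure c' η' := by
  have h0 : (0 : ℂ) ∈ admissibleSet lam c η ∩ admissibleSet lam c' η' :=
    ⟨zero_mem_admissibleSet _ _ _, zero_mem_admissibleSet _ _ _⟩
  -- Near `0` both integrals are sums of the same power series. The intersection of the two
  -- admissible sets is star-shaped about `0`, hence connected.
  refine AnalyticOnNhd.eqOn_of_preconnected_of_eventuallyEq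
    (((differentiableOn_integral_mul_degExp hc hη hκ).analyticOnNhd
      (isOpen_admissibleSet _ _ _)).mono Set.inter_subset_left)
    (((differentiableOn_integral_mul_degExp hc' hη' hκ').analyticOnNhd
      (isOpen_admissibleSet _ _ _)).mono Set.inter_subset_right)
    (isPreconnected_of_star h0 fun y hy r h0 h1 =>
      ⟨ofReal_mul_mem_admissibleSet hy.1 h0 h1, ofReal_mul_mem_admissibleSet hy.2 h0 h1⟩)
    h0 ?_ ⟨hx, hx'⟩
  filter_upwards [eventually_norm_mul_exp_lt lam c, eventually_norm_mul_exp_lt lam c']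
    with y hy hy'
  have h1 := hasSum_integral_mul_degExp hlam hc hη hκ hy
  simp_rw [h] at h1
  exact h1.unique (hasSum_integral_mul_degExp hlam hc' hη' hκ' hy')

end ParametricIntegral

/-! ### The power kernel and the logarithmic kernel. -/

/-- A kernel on the Hankel contour whose exponential moments are `(n + δ)^{-s}`. -/
def HasPolyMoments (c η : ℝ) (δ s : ℂ) (κ : ℂ → ℂ) : Prop :=
  Integrable κ (hankelMeasure c η) ∧
    ∀ n : ℕ, ∫ z, κ z * exp (n * z) ∂hankelMeasure c η = ((n : ℂ) + δ) ^ (-s)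

section Kernels

variable {c η : ℝ} {δ : ℂ}

lemma re_natCast_add_pos (hδ : 0 < δ.re) (n : ℕ) : 0 < ((n : ℂ) + δ).re := by
  have : (0 : ℝ) ≤ n := Nat.cast_nonneg n
  simp only [add_re, natCast_re]
  linarith

lemma integrable_cpow_kernel (hc : 0 < c) (hη : 0 < η) (hδ : 0 < δ.re) (s : ℂ) :
    Integrable (fun z => z ^ (s - 1) * (hankelDir η z * exp (δ * z))) (hankelMeasure c η) :=
  integrable_cpow_mul hc hη (s - 1) hδ (measurable_hankelDir_mul_exp η δ)
    (norm_hankelDir_mul_exp_le δ)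

lemma integral_cpow_kernel_mul_exp (hc : 0 < c) (hη : 0 < η) (hδ : 0 < δ.re) (s : ℂ) (n : ℕ) :
    ∫ z, z ^ (s - 1) * (hankelDir η z * exp (δ * z)) * exp (n * z) ∂hankelMeasure c η
      = 2 * Real.pi * I * ((n : ℂ) + δ) ^ (-s) * (Gamma (1 - s))⁻¹ := by
  rw [← integral_hankelMeasure_cpow_mul_exp hc hη (re_natCast_add_pos hδ n) s]
  refine integral_congr_ae (ae_of_all _ fun z => ?_)
  simp only
  rw [add_mul, exp_add]
  ring

lemma hasPolyMoments_pow (hc : 0 < c) (hη : 0 < η) (hδ : 0 < δ.re) {s : ℂ}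
    (hs : ∀ m : ℕ, 1 ≤ m → s ≠ (m : ℂ)) :
    HasPolyMoments c η δ s (fun z => Gamma (1 - s) / (2 * Real.pi * I) *
      (z ^ (s - 1) * (hankelDir η z * exp (δ * z)))) := by
  refine ⟨(integrable_cpow_kernel hc hη hδ s).const_mul _, fun n => ?_⟩
  have hG : Gamma (1 - s) ≠ 0 := Gamma_ne_zero fun m h => hs (m + 1) (by omega) (by
    push_cast; linear_combination -h)
  simp_rw [mul_assoc (Gamma (1 - s) / (2 * Real.pi * I))]
  rw [integral_const_mul, integral_cpow_kernel_mul_exp hc hη hδ]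
  have := Real.pi_ne_zero
  field_simp

lemma hasPolyMoments_log (hc : 0 < c) (hη : 0 < η) (hδ : 0 < δ.re) {m : ℕ} (hm : 1 ≤ m) :
    HasPolyMoments c η δ m (fun z => (-1) ^ m / (2 * Real.pi * I * ((m - 1).factorial : ℂ)) *
      (log z * z ^ ((m : ℂ) - 1) * (hankelDir η z * exp (δ * z)))) := by
  refine ⟨((hasDerivAt_integral_cpow_mul hc hη (m : ℂ) hδ (measurable_hankelDir_mul_exp η δ)
    (norm_hankelDir_mul_exp_le δ)).1).const_mul _, fun n => ?_⟩
  simp_rw [mul_assoc ((-1) ^ m / (2 * Real.pi * I * ((m - 1).factorial : ℂ)))]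
  have h1 : ∫ z, log z * z ^ ((m : ℂ) - 1) * (hankelDir η z * exp (δ * z)) * exp (n * z)
      ∂hankelMeasure c η
      = ∫ z, log z * z ^ ((m : ℂ) - 1) * (hankelDir η z * exp (((n : ℂ) + δ) * z))
      ∂hankelMeasure c η := by
    refine integral_congr_ae (ae_of_all _ fun z => ?_)
    simp only
    rw [add_mul, exp_add]
    ring
  rw [integral_const_mul, h1,
    integral_hankelMeasure_log_mul_cpow_mul_exp hc hη (re_natCast_add_pos hδ n) hm]
  have h2 : ((m - 1).factorial : ℂ) ≠ 0 := by exact_mod_cast (m - 1).factorial_ne_zero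
  have h3 : ((-1 : ℂ) ^ m) * (-1) ^ m = 1 := by rw [← mul_pow]; simp
  have := Real.pi_ne_zero
  field_simp
  linear_combination ((n : ℂ) + δ) ^ (-(m : ℂ)) * h3

/-- The logarithmic kernel covers the positive integers, where all moments of the power kernel
vanish and it cannot be normalised. -/
lemma exists_hasPolyMoments (hc : 0 < c) (hη : 0 < η) (hδ : 0 < δ.re) (s : ℂ) :
    ∃ κ, HasPolyMoments c η δ s κ := by
  by_cases h : ∀ m : ℕ, 1 ≤ m → s ≠ (m : ℂ)
  · exact ⟨_, hasPolyMoments_pow hc hη hδ h⟩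
  · push Not at h
    obtain ⟨m, hm, rfl⟩ := h
    exact ⟨_, hasPolyMoments_log hc hη hδ hm⟩

end Kernels

/-! ### The analytic continuation of the series. -/

section Continuation

variable {lam : ℝ} {δ s : ℂ}

lemma hasSum_degPolyexpTerm {c η : ℝ} {κ : ℂ → ℂ} (hlam : lam ≠ 0) (hc : 0 < c) (hη : 0 < η)
    (hκ : HasPolyMoments c η δ s κ) {x : ℂ} (hx : ‖(lam : ℂ) * x‖ * Real.exp c < 1) :
    HasSum (degPolyexpTerm lam x δ s)
      (∫ z, κ z * degExp lam (x * exp z) ∂hankelMeasure c η) := by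
  refine (hasSum_integral_mul_degExp hlam hc hη hκ.1 hx).congr_fun fun n => ?_
  rw [hκ.2 n, cpow_neg, degPolyexpTerm, div_mul_eq_div_div, div_eq_mul_inv _ (_ ^ s)]
  ring

lemma admissibleSet_subset {c η : ℝ} (hc : 0 < c) (hη : 0 < η) :
    admissibleSet lam c η ⊆ degExpDomain lam := fun x hx => by
  simpa using hx (exp 0) (exp_mem_expSector (by simpa using hc.le) (by simpa using hη.le))

/-- The disc is invariant under rotation, so only `c` has to be small and `η` is arbitrary. -/
lemma exists_mem_admissibleSet {x : ℂ} (hx : ‖(lam : ℂ) * x‖ < 1) :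
    ∃ c : ℝ, 0 < c ∧ ‖(lam : ℂ) * x‖ * Real.exp c < 1 ∧ ∀ η, x ∈ admissibleSet lam c η := by
  have h1 : ∀ᶠ c in 𝓝 (0 : ℝ), ‖(lam : ℂ) * x‖ * Real.exp c < 1 := by
    have : Continuous fun c : ℝ => ‖(lam : ℂ) * x‖ * Real.exp c := by fun_prop
    exact this.continuousAt.eventually_lt continuousAt_const (by simpa using hx)
  obtain ⟨c, h2, hc⟩ := ((h1.filter_mono nhdsWithin_le_nhds).and
    (self_mem_nhdsWithin : Set.Ioi (0 : ℝ) ∈ 𝓝[>] 0)).exists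
  refine ⟨c, hc, h2, ?_⟩
  rintro η _ ⟨⟨r, θ⟩, ⟨hr, -⟩, rfl⟩
  refine mem_degExpDomain_of_norm_lt ?_
  rw [← mul_assoc, norm_mul, norm_mul _ (exp _), norm_exp_ofReal_mul_I, mul_one, norm_real,
    Real.norm_of_nonneg hr.1]
  exact (mul_le_mul_of_nonneg_left hr.2 (norm_nonneg _)).trans_lt h2

lemma exists_isDegPolyexpContinuation (hlam : lam ≠ 0) (hδ : 0 < δ.re) (s : ℂ) :
    ∃ E : ℂ → ℂ, IsDegPolyexpContinuation lam δ s E ∧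
      ∀ (x : ℂ) (c η : ℝ) (κ : ℂ → ℂ), 0 < c → 0 < η → HasPolyMoments c η δ s κ →
        x ∈ admissibleSet lam c η →
          E x = ∫ z, κ z * degExp lam (x * exp z) ∂hankelMeasure c η := by
  -- The value at `x` is that of any kernel on any contour admissible for `x`; equal moments make it
  -- independent of the choice. The default `0` occurs only where there is none.
  have h : ∀ x : ℂ, ∃ v : ℂ, ∀ (c η : ℝ) (κ : ℂ → ℂ), 0 < c → 0 < η →
      HasPolyMoments c η δ s κ → x ∈ admissibleSet lam c η →
        v = ∫ z, κ z * degExp lam (x * exp z) ∂hankelMeasure c η := by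
    intro x
    by_cases hx : ∃ (c η : ℝ) (κ : ℂ → ℂ), 0 < c ∧ 0 < η ∧ HasPolyMoments c η δ s κ ∧
        x ∈ admissibleSet lam c η
    · obtain ⟨c₀, η₀, κ₀, hc₀, hη₀, hκ₀, hx₀⟩ := hx
      refine ⟨∫ z, κ₀ z * degExp lam (x * exp z) ∂hankelMeasure c₀ η₀,
        fun c η κ hc hη hκ hx => ?_⟩
      exact integral_mul_degExp_eq_of_moments hlam hc₀ hη₀ hc hη hκ₀.1 hκ.1
        (fun n => (hκ₀.2 n).trans (hκ.2 n).symm) hx₀ hx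
    · exact ⟨0, fun c η κ hc hη hκ hxA => absurd ⟨c, η, κ, hc, hη, hκ, hxA⟩ hx⟩
  choose E hE using h
  refine ⟨E, ⟨fun x hx => ?_, fun x hx => ?_⟩, hE⟩
  · obtain ⟨ρ, hρ, hadm⟩ := exists_admissible hx
    have h2 := half_pos hρ
    have hA := (hadm _ _ h2 (half_lt_self hρ) h2 (half_lt_self hρ)).mem_admissibleSet
    obtain ⟨κ, hκ⟩ := exists_hasPolyMoments h2 h2 hδ s
    have hopen := isOpen_admissibleSet lam (ρ / 2) (ρ / 2)
    refine ((differentiableOn_integral_mul_degExp h2 h2 hκ.1).analyticOnNhd hopen x hA).congr ?_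
    filter_upwards [hopen.mem_nhds hA] with y hy using (hE y _ _ κ h2 h2 hκ hy).symm
  · obtain ⟨c, hc, hxc, hA⟩ := exists_mem_admissibleSet hx
    obtain ⟨κ, hκ⟩ := exists_hasPolyMoments hc one_pos hδ s
    rw [hE x c 1 κ hc one_pos hκ (hA 1)]
    exact hasSum_degPolyexpTerm hlam hc one_pos hκ hxc

lemma eventually_norm_mul_lt_one (lam : ℝ) : ∀ᶠ x in 𝓝 (0 : ℂ), ‖(lam : ℂ) * x‖ < 1 := by
  simpa using eventually_norm_mul_exp_lt lam 0

/-- Abel's theorem: wherever the series converges absolutely on the domain, its sum is the value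
of the analytic continuation. -/
lemma IsDegPolyexpContinuation.tsum_eq {E : ℂ → ℂ} (hE : IsDegPolyexpContinuation lam δ s E)
    {x : ℂ} (hx : x ∈ degExpDomain lam) (hsum : Summable (degPolyexpTerm lam x δ s)) :
    ∑' n, degPolyexpTerm lam x δ s n = E x := by
  by_cases hx0 : x = 0
  · exact (hE.hasSum x (by simp [hx0])).tsum_eq
  have hxpos : 0 < ‖x‖ := norm_pos_iff.2 hx0
  have hbound : ∀ y : ℂ, ‖y‖ ≤ ‖x‖ → ∀ n, ‖degPolyexpTerm lam y δ s n‖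
      ≤ ‖degPolyexpTerm lam x δ s n‖ := fun y hy n => by
    unfold degPolyexpTerm
    rw [norm_mul, norm_mul _ (x ^ n), norm_pow, norm_pow]
    gcongr
  have hcont : ∀ n, Differentiable ℂ fun y => degPolyexpTerm lam y δ s n := fun n => by
    unfold degPolyexpTerm; fun_prop
  have hF : DifferentiableOn ℂ (fun y => ∑' n, degPolyexpTerm lam y δ s n)
      (Metric.ball 0 ‖x‖) :=
    differentiableOn_tsum_of_summable_norm hsum.norm (fun n => (hcont n).differentiableOn)
      Metric.isOpen_ball fun n y hy => hbound y (mem_ball_zero_iff.1 hy).le n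
  have h0 : (0 : ℂ) ∈ degExpDomain lam ∩ Metric.ball 0 ‖x‖ :=
    ⟨zero_mem_degExpDomain lam, Metric.mem_ball_self hxpos⟩
  have heq : Set.EqOn E (fun y => ∑' n, degPolyexpTerm lam y δ s n)
      (degExpDomain lam ∩ Metric.ball 0 ‖x‖) := by
    refine AnalyticOnNhd.eqOn_of_preconnected_of_eventuallyEq
      (hE.analytic.mono Set.inter_subset_left)
      ((hF.analyticOnNhd Metric.isOpen_ball).mono Set.inter_subset_right)
      (isPreconnected_of_star h0 fun y hy r hr0 hr1 =>
        ⟨ofReal_mul_mem_degExpDomain hy.1 hr0 hr1, mem_ball_zero_iff.2 ?_⟩) h0 ?_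
    · rw [norm_mul, norm_real, Real.norm_of_nonneg hr0]
      exact (mul_le_of_le_one_left (norm_nonneg _) hr1).trans_lt (mem_ball_zero_iff.1 hy.2)
    · filter_upwards [eventually_norm_mul_lt_one lam] with y hy using (hE.hasSum y hy).tsum_eq.symm
  have hline : Tendsto (fun r : ℝ => (r : ℂ) * x) (𝓝[<] 1) (𝓝 x) := by
    have : Continuous fun r : ℝ => (r : ℂ) * x := by fun_prop
    simpa using (this.tendsto 1).mono_left nhdsWithin_le_nhds
  have hIoo : ∀ᶠ r : ℝ in 𝓝[<] 1, r ∈ Set.Ioo (0 : ℝ) 1 := Ioo_mem_nhdsLT one_pos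
  have hnorm : ∀ r : ℝ, r ∈ Set.Ioo (0 : ℝ) 1 → ‖(r : ℂ) * x‖ < ‖x‖ := fun r hr => by
    rw [norm_mul, norm_real, Real.norm_of_nonneg hr.1.le]
    exact mul_lt_of_lt_one_left hxpos hr.2
  have h1 : Tendsto (fun r : ℝ => E (r * x)) (𝓝[<] 1) (𝓝 (E x)) :=
    (hE.analytic x hx).continuousAt.tendsto.comp hline
  -- Absolute convergence at `x` dominates the series at every `r * x` with `0 < r < 1`, so the
  -- radial limit may be taken termwise.
  have h2 : Tendsto (fun r : ℝ => ∑' n, degPolyexpTerm lam (r * x) δ s n) (𝓝[<] 1)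
      (𝓝 (∑' n, degPolyexpTerm lam x δ s n)) :=
    tendsto_tsum_of_dominated_convergence hsum.norm
      (fun n => ((hcont n).continuous.tendsto x).comp hline)
      (hIoo.mono fun r hr n => hbound _ (hnorm r hr).le n)
  refine tendsto_nhds_unique (h2.congr' ?_) h1
  filter_upwards [hIoo] with r hr
  exact (heq ⟨ofReal_mul_mem_degExpDomain hx hr.1.le hr.2.le,
    mem_ball_zero_iff.2 (hnorm r hr)⟩).symm

lemma IsDegPolyexpContinuation.eqOn {E E' : ℂ → ℂ} (hE : IsDegPolyexpContinuation lam δ s E)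
    (hE' : IsDegPolyexpContinuation lam δ s E') : Set.EqOn E E' (degExpDomain lam) := by
  refine hE.analytic.eqOn_of_preconnected_of_eventuallyEq hE'.analytic
    (isPreconnected_of_star (zero_mem_degExpDomain lam)
      fun y hy r hr0 hr1 => ofReal_mul_mem_degExpDomain hy hr0 hr1) (zero_mem_degExpDomain lam) ?_
  filter_upwards [eventually_norm_mul_lt_one lam] with y hy using
    (hE.hasSum y hy).unique (hE'.hasSum y hy)

/-- Makes the case distinction in `degPolyexp` harmless: the series, also on or beyond the circle
`|λ x| = 1`, and the chosen continuation both agree with `E`. -/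
lemma IsDegPolyexpContinuation.degPolyexp_eq {E : ℂ → ℂ}
    (hE : IsDegPolyexpContinuation lam δ s E) {x : ℂ} (hx : x ∈ degExpDomain lam) :
    degPolyexp lam x δ s = E x := by
  unfold degPolyexp
  have hex : ∃ E : ℂ → ℂ, IsDegPolyexpContinuation lam δ s E := ⟨E, hE⟩
  split_ifs with h
  · exact hE.tsum_eq hx h
  · exact hex.choose_spec.eqOn hE hx

lemma analyticOnNhd_degPolyexp (hlam : lam ≠ 0) (hδ : 0 < δ.re) (s : ℂ) :
    AnalyticOnNhd ℂ (fun x : ℂ => degPolyexp lam x δ s) (degExpDomain lam) := by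
  obtain ⟨E, hE, -⟩ := exists_isDegPolyexpContinuation hlam hδ s
  exact hE.analytic.congr (isOpen_degExpDomain lam) fun x hx => (hE.degPolyexp_eq hx).symm

lemma degPolyexp_eq_integral (hlam : lam ≠ 0) (hδ : 0 < δ.re) {c η : ℝ} {κ : ℂ → ℂ} (hc : 0 < c)
    (hη : 0 < η) (hκ : HasPolyMoments c η δ s κ) {x : ℂ} (hx : x ∈ admissibleSet lam c η) :
    degPolyexp lam x δ s = ∫ z, κ z * degExp lam (x * exp z) ∂hankelMeasure c η := by
  obtain ⟨E, hE, h⟩ := exists_isDegPolyexpContinuation hlam hδ s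
  rw [hE.degPolyexp_eq (admissibleSet_subset hc hη hx), h x c η κ hc hη hκ hx]

end Continuation

/-! ### Return to Hankel integrals, and the limit at positive integers. -/

section HankelIntegrals

variable {lam c η : ℝ} {δ x : ℂ}

lemma integrable_of_hankelDir_mul {μ : Measure ℂ} {f : ℂ → ℂ} (hf : Measurable f)
    (h : Integrable (fun z => hankelDir η z * f z) μ) : Integrable f μ :=
  h.mono hf.aestronglyMeasurable (ae_of_all _ fun z => by
    rw [norm_mul, norm_hankelDir, one_mul])

lemma measurable_degExp_mul_exp (lam : ℝ) (x : ℂ) :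
    Measurable fun z => degExp lam (x * exp z) :=
  (measurable_degExp lam).comp (by fun_prop)

lemma integrable_cpow_integrand (hc : 0 < c) (hη : 0 < η) (hδ : 0 < δ.re)
    (hx : x ∈ admissibleSet lam c η) (s : ℂ) :
    Integrable (fun t : ℂ => t ^ (s - 1) * exp (δ * t) * degExp lam (x * exp t))
      (hankelMeasure c η) := by
  refine integrable_of_hankelDir_mul (η := η)
    ((by fun_prop : Measurable fun t : ℂ => t ^ (s - 1) * exp (δ * t)).mul
      (measurable_degExp_mul_exp lam x)) ?_
  refine (integrable_mul_degExp hc hη (integrable_cpow_kernel hc hη hδ s) hx).congr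
    (ae_of_all _ fun z => ?_)
  simp only
  ring

lemma hankelIntegral_cpow_eq (hc : 0 < c) (hη : 0 < η) (hδ : 0 < δ.re)
    (hx : x ∈ admissibleSet lam c η) (s : ℂ) :
    hankelIntegral c η (fun t : ℂ => t ^ (s - 1) * exp (δ * t) * degExp lam (x * exp t))
      = ∫ z, z ^ (s - 1) * (hankelDir η z * exp (δ * z) * degExp lam (x * exp z))
        ∂hankelMeasure c η := by
  rw [hankelIntegral_eq hη (integrable_cpow_integrand hc hη hδ hx s)]
  refine integral_congr_ae (ae_of_all _ fun z => ?_)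
  simp only
  ring

lemma natCast_cpow_sub_one {m : ℕ} (hm : 1 ≤ m) (z : ℂ) : z ^ ((m : ℂ) - 1) = z ^ (m - 1) := by
  rw [← cpow_natCast, Nat.cast_sub hm, Nat.cast_one]

lemma integrable_log_integrand (hc : 0 < c) (hη : 0 < η) (hδ : 0 < δ.re)
    (hx : x ∈ admissibleSet lam c η) {m : ℕ} (hm : 1 ≤ m) :
    Integrable (fun t : ℂ => t ^ (m - 1) * exp (δ * t) * degExp lam (x * exp t) * log t)
      (hankelMeasure c η) := by
  refine integrable_of_hankelDir_mul (η := η)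
    (((by fun_prop : Measurable fun t : ℂ => t ^ (m - 1) * exp (δ * t)).mul
      (measurable_degExp_mul_exp lam x)).mul measurable_log) ?_
  refine (integrable_mul_degExp hc hη (hasDerivAt_integral_cpow_mul hc hη (m : ℂ) hδ
    (measurable_hankelDir_mul_exp η δ) (norm_hankelDir_mul_exp_le δ)).1 hx).congr
    (ae_of_all _ fun z => ?_)
  simp only
  rw [natCast_cpow_sub_one hm]
  ring

lemma hankelIntegral_log_eq (hc : 0 < c) (hη : 0 < η) (hδ : 0 < δ.re)
    (hx : x ∈ admissibleSet lam c η) {m : ℕ} (hm : 1 ≤ m) :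
    hankelIntegral c η (fun t : ℂ => t ^ (m - 1) * exp (δ * t) * degExp lam (x * exp t) * log t)
      = ∫ z, log z * z ^ ((m : ℂ) - 1) * (hankelDir η z * exp (δ * z) * degExp lam (x * exp z))
        ∂hankelMeasure c η := by
  rw [hankelIntegral_eq hη (integrable_log_integrand hc hη hδ hx hm)]
  refine integral_congr_ae (ae_of_all _ fun z => ?_)
  simp only
  rw [natCast_cpow_sub_one hm]
  ring

lemma degPolyexp_eq_hankelIntegral (hlam : lam ≠ 0) (hc : 0 < c) (hη : 0 < η) (hδ : 0 < δ.re)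
    (hx : x ∈ admissibleSet lam c η) {s : ℂ} (hs : ∀ m : ℕ, 1 ≤ m → s ≠ (m : ℂ)) :
    degPolyexp lam x δ s = Gamma (1 - s) / (2 * (Real.pi : ℂ) * I) *
      hankelIntegral c η (fun t : ℂ => t ^ (s - 1) * exp (δ * t) * degExp lam (x * exp t)) := by
  rw [degPolyexp_eq_integral hlam hδ hc hη (hasPolyMoments_pow hc hη hδ hs) hx,
    hankelIntegral_cpow_eq hc hη hδ hx, ← integral_const_mul]
  refine integral_congr_ae (ae_of_all _ fun z => ?_)
  simp only
  ring

lemma degPolyexp_eq_hankelIntegral_log (hlam : lam ≠ 0) (hc : 0 < c) (hη : 0 < η)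
    (hδ : 0 < δ.re) (hx : x ∈ admissibleSet lam c η) {m : ℕ} (hm : 1 ≤ m) :
    degPolyexp lam x δ m = (-1) ^ m / (2 * (Real.pi : ℂ) * I * ((m - 1).factorial : ℂ)) *
      hankelIntegral c η
        (fun t : ℂ => t ^ (m - 1) * exp (δ * t) * degExp lam (x * exp t) * log t) := by
  rw [degPolyexp_eq_integral hlam hδ hc hη (hasPolyMoments_log hc hη hδ hm) hx,
    hankelIntegral_log_eq hc hη hδ hx hm, ← integral_const_mul]
  refine integral_congr_ae (ae_of_all _ fun z => ?_)
  simp only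
  ring

/-- As `1/Γ(1-m) = 0`, the power kernel has the same moments as the zero kernel. -/
lemma hankelIntegral_cpow_natCast_eq_zero (hlam : lam ≠ 0) (hc : 0 < c) (hη : 0 < η)
    (hδ : 0 < δ.re) (hx : x ∈ admissibleSet lam c η) {m : ℕ} (hm : 1 ≤ m) :
    hankelIntegral c η
      (fun t : ℂ => t ^ ((m : ℂ) - 1) * exp (δ * t) * degExp lam (x * exp t)) = 0 := by
  have h := integral_mul_degExp_eq_of_moments hlam (κ' := fun _ => 0) hc hη hc hη
    (integrable_cpow_kernel hc hη hδ m) (integrable_zero _ _ _) (fun n => by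
      rw [integral_cpow_kernel_mul_exp hc hη hδ, Gamma_one_sub_natCast hm]; simp) hx hx
  rw [hankelIntegral_cpow_eq hc hη hδ hx]
  simpa [mul_assoc] using h

lemma tendsto_hankelIntegral_degPolyexp (hlam : lam ≠ 0) (hc : 0 < c) (hη : 0 < η)
    (hδ : 0 < δ.re) (hx : x ∈ admissibleSet lam c η) {m : ℕ} (hm : 1 ≤ m) :
    Tendsto (fun s : ℂ => Gamma (1 - s) / (2 * (Real.pi : ℂ) * I) *
        hankelIntegral c η (fun t : ℂ => t ^ (s - 1) * exp (δ * t) * degExp lam (x * exp t)))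
      (𝓝[≠] (m : ℂ)) (𝓝 (degPolyexp lam x δ m)) := by
  obtain ⟨ε, hε, -, C, hC0, hC⟩ :=
    exists_bound_mul_expSector (differentiableOn_degExp.continuousOn) hx
  have hX := (hasDerivAt_integral_cpow_mul hc hη (m : ℂ) hδ
    (h := fun z => hankelDir η z * exp (δ * z) * degExp lam (x * exp z))
    (C₀ := Real.exp (‖δ‖ * η) * C)
    ((measurable_hankelDir_mul_exp η δ).mul (measurable_degExp_mul_exp lam x)) (fun z hz => by
      rw [norm_mul, mul_right_comm]
      exact mul_le_mul (norm_hankelDir_mul_exp_le δ z hz)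
        (hC x (Metric.mem_closedBall_self hε.le) _ (exp_mem_expSector hz.2.1 hz.2.2))
        (norm_nonneg _) (by positivity))).2
  have hfac : ((m - 1).factorial : ℂ) ≠ 0 := by exact_mod_cast (m - 1).factorial_ne_zero
  have hsign : ((-1 : ℂ) ^ m) * (-1) ^ m = 1 := by rw [← mul_pow]; simp
  have hsign0 : (-1 : ℂ) ^ m ≠ 0 := pow_ne_zero _ (by simp)
  have h0 : ∫ z, z ^ ((m : ℂ) - 1) * (hankelDir η z * exp (δ * z) * degExp lam (x * exp z))
      ∂hankelMeasure c η = 0 := by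
    rw [← hankelIntegral_cpow_eq hc hη hδ hx]
    exact hankelIntegral_cpow_natCast_eq_zero hlam hc hη hδ hx hm
  -- `Γ(1-s)` times the integral is read as the integral divided by `1/Γ(1-s)`. Both vanish at `m`,
  -- and the derivative of the numerator is the logarithmic integral.
  have key := (tendsto_div_of_hasDerivAt hX (hasDerivAt_Gamma_one_sub_inv hm) h0
    (by rw [Gamma_one_sub_natCast hm, inv_zero]) (mul_ne_zero hsign0 hfac)).div_const
    (2 * (Real.pi : ℂ) * I)
  rw [degPolyexp_eq_hankelIntegral_log hlam hc hη hδ hx hm, hankelIntegral_log_eq hc hη hδ hx hm]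
  have := Real.pi_ne_zero
  convert key using 1
  · ext s
    rw [hankelIntegral_cpow_eq hc hη hδ hx, div_inv_eq_mul]
    ring
  · congr 1
    field_simp
    rw [← pow_mul, pow_mul']
    simp

end HankelIntegrals
theorem theorem5 (lam : ℝ) (hlam : lam ≠ 0) (δ : ℂ) (hδ : 0 < δ.re) :
    -- the function `e_λ(x, δ | s)` is well defined: sum of its series on the disc `|λ x| < 1`,
    -- and holomorphic in `x` on the cut plane (on all of `ℂ` if `1/λ` is a natural number)
    (∀ s : ℂ,
      (∀ x : ℂ, ‖(lam : ℂ) * x‖ < 1 → Summable (degPolyexpTerm lam x δ s)) ∧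
      AnalyticOnNhd ℂ (fun x : ℂ => degPolyexp lam x δ s) (degExpDomain lam)) ∧
    ∀ x ∈ degExpDomain lam,
      -- all Hankel contours that are close enough to the negative real axis are admissible
      (∃ ρ : ℝ, 0 < ρ ∧
        ∀ c η : ℝ, 0 < c → c < ρ → 0 < η → η < ρ → HankelAdmissible lam x c η) ∧
      ∀ c η : ℝ, HankelAdmissible lam x c η →
        (∀ s : ℂ, (∀ m : ℕ, 1 ≤ m → s ≠ (m : ℂ)) →
          HankelIntegrable c η
            (fun t : ℂ => t ^ (s - 1) * exp (δ * t) * degExp lam (x * exp t)) ∧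
          degPolyexp lam x δ s =
            Gamma (1 - s) / (2 * (Real.pi : ℂ) * I) *
              hankelIntegral c η
                (fun t : ℂ => t ^ (s - 1) * exp (δ * t) * degExp lam (x * exp t))) ∧
        (∀ m : ℕ, 1 ≤ m →
          HankelIntegrable c η
            (fun t : ℂ => t ^ (m - 1) * exp (δ * t) * degExp lam (x * exp t) * log t) ∧
          degPolyexp lam x δ (m : ℂ) =
            (-1) ^ m / (2 * (Real.pi : ℂ) * I * ((m - 1).factorial : ℂ)) *
              hankelIntegral c η
                (fun t : ℂ => t ^ (m - 1) * exp (δ * t) * degExp lam (x * exp t) * log t) ∧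
          Tendsto
            (fun s : ℂ => Gamma (1 - s) / (2 * (Real.pi : ℂ) * I) *
              hankelIntegral c η
                (fun t : ℂ => t ^ (s - 1) * exp (δ * t) * degExp lam (x * exp t)))
            (𝓝[≠] (m : ℂ)) (𝓝 (degPolyexp lam x δ (m : ℂ)))) := by
  refine ⟨fun s => ⟨fun x hx => ?_, analyticOnNhd_degPolyexp hlam hδ s⟩,
    fun x hx => ⟨exists_admissible hx, fun c η hadm => ?_⟩⟩
  · obtain ⟨E, hE, -⟩ := exists_isDegPolyexpContinuation hlam hδ s
    exact (hE.hasSum x hx).summable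
  · obtain ⟨hc, hη, -⟩ := id hadm
    have hA := hadm.mem_admissibleSet
    refine ⟨fun s hs => ⟨?_, degPolyexp_eq_hankelIntegral hlam hc hη hδ hA hs⟩,
      fun m hm => ⟨?_, degPolyexp_eq_hankelIntegral_log hlam hc hη hδ hA hm,
        tendsto_hankelIntegral_degPolyexp hlam hc hη hδ hA hm⟩⟩
    · exact (hankelIntegrable_iff hη _).2 (integrable_cpow_integrand hc hη hδ hA s)
    · exact (hankelIntegrable_iff hη _).2 (integrable_log_integrand hc hη hδ hA hm)
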